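/- Let $R$ be a commutative ring with unity. An exact sequence of $R$-modules $0\to N\to M\to L\to 0$ is called RD-exact if the image $N'$ of $N$ in $M$ satisfies $rM\cap N'=rN'$ for every $r\in R$, and pure-exact if it remains exact after tensoring with any $R$-module. An $R$-module $F$ is RD-flat if $0\to F\otimes_R N\to F\otimes_R M\to F\otimes_R L\to 0$ is exact for every RD-exact sequence $0\to N\to M\to L\to 0$; it is RD-injective if $0\to\mathrm{Hom}_R(L,F)\to\mathrm{Hom}_R(M,F)\to\mathrm{Hom}_R(N,F)\to 0$ is exact for every such sequence; it is RD-coflat if every RD-exact sequence $0\to F\to P\to Q\to 0$ is pure-exact. A module is uniserial if its set of submodules is totally ordered by inclusion. A family $\mathcal F$ of ideals is directed if for all $U,V\in\mathcal F$ there is $W\in\mathcal F$ with $U+V\subseteq W$. Theorem. For every commutative ring $R$ the following conditions are equivalent: (1) every simple $R$-module is RD-flat; (2) every simple $R$-module is RD-injective; (3) every $R$-module of finite length is RD-flat; (4) every $R$-module of finite length is RD-injective; (5) every artinian $R$-module is RD-flat; (6) every noetherian $R$-module is RD-coflat; (7) for each maximal ideal $P$ of $R$, the family of proper principal ideals of the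 localization $R_P$ is directed. Moreover, if $R$ satisfies these conditions, then every artinian $R$-module is a finite direct sum of uniserial submodules and every noetherian $R$-module is a direct sum of submodules each generated by two elements. The converse of this last assertion is not true: there is a commutative ring $R$ such that every artinian $R$-module is a finite direct sum of uniserial submodules and every noetherian $R$-module is a direct sum of submodules each generated by two elements, but $R$ does not satisfy the equivalent conditions (1)-(7). -/

import Mathlib

open scoped TensorProduct Pointwise

universe u

namespace RDPurity

section Sequences

variable {R : Type u} [CommRing R]
variable {N M L : Type u} [AddCommGroup N] [Module R N] [AddCommGroup M] [Module R M]
  [AddCommGroup L] [Module R L]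

/-- The sequence `0 → N → M → L → 0` with maps `f` and `g` is exact. -/
def IsShortExact (f : N →ₗ[R] M) (g : M →ₗ[R] L) : Prop :=
  Function.Injective f ∧ Function.Exact f g ∧ Function.Surjective g

/-- `F` is a relatively divisible submodule of `E`: `rE ∩ F = rF` for every `r`. -/
def IsRDSubmodule (F : Submodule R M) : Prop :=
  ∀ r : R, r • (⊤ : Submodule R M) ⊓ F = r • F

/-- The sequence `0 → N → M → L → 0` is RD-exact: it is exact and the image of `N` is a relatively
divisible submodule of `M`. -/
def IsRDExact (f : N →ₗ[R] M) (g : M →ₗ[R] L) : Prop :=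
  IsShortExact f g ∧ IsRDSubmodule (LinearMap.range f)

/-- The sequence `0 → N → M → L → 0` is pure-exact: it is exact and remains exact when tensored
with any module. -/
def IsPureExact (f : N →ₗ[R] M) (g : M →ₗ[R] L) : Prop :=
  IsShortExact f g ∧
    ∀ (X : Type u) [AddCommGroup X] [Module R X], IsShortExact (f.lTensor X) (g.lTensor X)

/-- A family of submodules of `M` is directed: any two members have their sum contained in a third
one. -/
def IsDirectedFamily (F : Set (Submodule R M)) : Prop :=
  ∀ U ∈ F, ∀ V ∈ F, ∃ W ∈ F, U + V ≤ W

end Sequences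

section Modules

variable (R : Type u) [CommRing R] (M : Type u) [AddCommGroup M] [Module R M]

/-- `M` is RD-flat: tensoring with `M` preserves the exactness of every RD-exact sequence. -/
def IsRDFlat : Prop :=
  ∀ (H F L : Type u) [AddCommGroup H] [Module R H] [AddCommGroup F] [Module R F]
    [AddCommGroup L] [Module R L] (f : H →ₗ[R] F) (g : F →ₗ[R] L),
    IsRDExact f g → IsShortExact (f.lTensor M) (g.lTensor M)

/-- `M` is RD-injective: for every RD-exact sequence `0 → H → F → L → 0` the sequence
`0 → Hom(L, M) → Hom(F, M) → Hom(H, M) → 0` is exact. -/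
def IsRDInjective : Prop :=
  ∀ (H F L : Type u) [AddCommGroup H] [Module R H] [AddCommGroup F] [Module R F]
    [AddCommGroup L] [Module R L] (f : H →ₗ[R] F) (g : F →ₗ[R] L),
    IsRDExact f g → IsShortExact (g.lcomp R M) (f.lcomp R M)

/-- `M` is RD-coflat: every RD-exact sequence `0 → M → F → L → 0` is pure-exact. -/
def IsRDCoflat : Prop :=
  ∀ (F L : Type u) [AddCommGroup F] [Module R F] [AddCommGroup L] [Module R L]
    (f : M →ₗ[R] F) (g : F →ₗ[R] L), IsRDExact f g → IsPureExact f g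

/-- `M` is uniserial: its submodules are totally ordered by inclusion. -/
def IsUniserial : Prop :=
  ∀ A B : Submodule R M, A ≤ B ∨ B ≤ A

/-- `M` is the (internal) direct sum of finitely many uniserial submodules. -/
def IsFiniteSumOfUniserials : Prop :=
  ∃ (n : ℕ) (N : Fin n → Submodule R M), DirectSum.IsInternal N ∧ ∀ i, IsUniserial R (N i)

/-- `M` is the (internal) direct sum of a family of submodules, each of which can be generated by
two elements. -/
def IsSumOfTwoGenerated : Prop :=
  ∃ (ι : Type u) (_ : DecidableEq ι) (N : ι → Submodule R M),
    DirectSum.IsInternal N ∧ ∀ i, ∃ x y : M, N i = Submodule.span R {x, y}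

end Modules

/-- For each maximal ideal `P` of `R`, the family of proper principal ideals of `R_P` is
directed. -/
def LocallyDirected (R : Type u) [CommRing R] : Prop :=
  ∀ (P : Ideal R) [P.IsMaximal],
    IsDirectedFamily {I : Ideal (Localization.AtPrime P) | I ≠ ⊤ ∧ Submodule.IsPrincipal I}

end RDPurity

namespace RDPurity

/-! ### Directedness at a maximal ideal, stated in `R` -/

/-! Every condition is played off against (7), read in `R` as `DirectedAt P`: after multiplication
by some `t ∉ P`, any two elements of `P` become multiples of one element of `P`.

Sufficiency of (7). `R ⧸ I` is RD-flat once `N ∩ IF = IN` for RD-submodules `N` of `F`. If `I` is,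
locally at `P`, a directed union of principal ideals, an element of `IF` lies locally in some `cF`
with `c ∈ I`, and relative divisibility moves it into `cN`. For `P ^ n ≤ I` this local shape holds
(`DirectedAt.exists_of_pow_le`): if `p ∈ P` is not in `P ^ 2`, every element of `P` is locally a
multiple of `p`, and unless `P ≤ I` the ideal `I` is locally generated by a power of `p`. Moreover
`R ⧸ I` is then self-injective, so RD-flatness gives RD-injectivity. Modules of finite length are
finite direct sums of such quotients, since an indecomposable one is primary and uniserial. Artinian
modules follow by passing to finitely generated submodules, noetherian ones by Krull's intersection
theorem.

Necessity of (7). Each test concerns a pair `a, b ∈ P`. RD-flatness of `R ⧸ P` is tested on a cover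
of `R² ⧸ R(a, b)` by cyclically presented modules, RD-coflatness on the embedding of `R ⧸ P` into
`R² ⧸ P(a, b)`. RD-injectivity of `R ⧸ P` implies its RD-flatness by vector space duality.

The decompositions need only the weaker `CotangentCyclic`: `P = (p) + P ^ 2` for every maximal `P`.
Indecomposable artinian modules are then uniserial. An indecomposable noetherian module is faithful
over a connected noetherian ring which is artinian local or a Dedekind domain; the module is cyclic
in the first case and isomorphic to an ideal in the second. Perfect rings of characteristic `p` have
`P = P ^ 2`, so they satisfy the weaker condition, but the perfect closure of a polynomial ring in
two variables over the field with two elements fails (7) at the origin. -/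

/-- Elementwise form, over `R`, of the directedness of the proper principal ideals of `R_P`. -/
def DirectedAt {R : Type*} [CommRing R] (P : Ideal R) : Prop :=
  ∀ a ∈ P, ∀ b ∈ P, ∃ c ∈ P, ∃ t ∉ P, ∃ r s, t * a = r * c ∧ t * b = s * c

/-- Denominators are units of `R_P`, so generators of principal ideals can be taken in `R`; the
factor `t` clears the denominators of the quotients. -/
theorem isDirectedFamily_localization_iff {R : Type u} [CommRing R] (P : Ideal R) [hP : P.IsPrime] :
    IsDirectedFamily {I : Ideal (Localization.AtPrime P) | I ≠ ⊤ ∧ Submodule.IsPrincipal I} ↔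
      DirectedAt P := by
  have key (a : R) (s : P.primeCompl) :
      Ideal.span {IsLocalization.mk' (Localization.AtPrime P) a s} ≠ ⊤ ↔ a ∈ P := by
    rw [Ne, Ideal.span_singleton_eq_top, IsLocalization.AtPrime.isUnit_mk'_iff _ P]
    simp [Ideal.primeCompl]
  constructor
  · intro h a ha b hb
    obtain ⟨W, ⟨hW, ⟨w, hw⟩⟩, hle⟩ := h
      (Ideal.span {IsLocalization.mk' (Localization.AtPrime P) a 1}) ⟨(key a 1).2 ha, ⟨_, rfl⟩⟩
      (Ideal.span {IsLocalization.mk' (Localization.AtPrime P) b 1}) ⟨(key b 1).2 hb, ⟨_, rfl⟩⟩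
    obtain ⟨c, s, rfl⟩ := IsLocalization.exists_mk'_eq P.primeCompl w
    have hc : c ∈ P := (key c s).1 (by rw [hw] at hW; exact hW)
    rw [Submodule.add_eq_sup] at hle
    have h1 : ∀ x : R, IsLocalization.mk' (Localization.AtPrime P) x (1 : P.primeCompl) ∈ W →
        ∃ t ∉ P, ∃ r, t * x = r * c := by
      intro x hx
      rw [hw] at hx
      obtain ⟨y, hy⟩ := Ideal.mem_span_singleton'.1 hx
      obtain ⟨r, s', rfl⟩ := IsLocalization.exists_mk'_eq P.primeCompl y
      rw [← IsLocalization.mk'_mul, IsLocalization.mk'_eq_iff_eq] at hy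
      obtain ⟨t, ht⟩ := (IsLocalization.eq_iff_exists P.primeCompl _).1 hy
      refine ⟨t * (s' * s), (t * (s' * s)).2, t * r, ?_⟩
      simpa [mul_assoc] using ht.symm
    obtain ⟨t, ht, r, hr⟩ := h1 a (hle (Ideal.mem_sup_left (Ideal.mem_span_singleton_self _)))
    obtain ⟨t', ht', r', hr'⟩ := h1 b (hle (Ideal.mem_sup_right (Ideal.mem_span_singleton_self _)))
    refine ⟨c, hc, t * t', fun h ↦ (hP.mem_or_mem h).elim ht ht', t' * r, t * r', ?_, ?_⟩
    · rw [mul_right_comm, mul_assoc t' r c, ← hr]; ring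
    · rw [mul_assoc, hr']; ring
  · rintro h U ⟨hU, ⟨u, hu⟩⟩ V ⟨hV, ⟨v, hv⟩⟩
    obtain ⟨a, s, rfl⟩ := IsLocalization.exists_mk'_eq P.primeCompl u
    obtain ⟨b, s', rfl⟩ := IsLocalization.exists_mk'_eq P.primeCompl v
    have hU' := hU
    have hV' := hV
    rw [hu] at hU'
    rw [hv] at hV'
    obtain ⟨c, hc, t, ht, r, r', h1, h2⟩ := h a ((key a s).1 hU') b ((key b s').1 hV')
    refine ⟨Ideal.span {IsLocalization.mk' (Localization.AtPrime P) c 1},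
      ⟨(key c 1).2 hc, ⟨_, rfl⟩⟩, ?_⟩
    have h3 : ∀ (x y : R) (s : P.primeCompl), t * x = y * c →
        IsLocalization.mk' (Localization.AtPrime P) x s ∈
          Ideal.span {IsLocalization.mk' (Localization.AtPrime P) c (1 : P.primeCompl)} := by
      intro x y s hxy
      refine Ideal.mem_span_singleton'.2 ⟨IsLocalization.mk' _ y (⟨t, ht⟩ * s : P.primeCompl), ?_⟩
      rw [← IsLocalization.mk'_mul, IsLocalization.mk'_eq_iff_eq]
      congr 1
      simp only [mul_one, Submonoid.coe_mul]
      rw [← hxy]; ring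
    rw [Submodule.add_eq_sup, hu, hv]
    exact sup_le ((Ideal.span_singleton_le_iff_mem _).2 (h3 a r s h1))
      ((Ideal.span_singleton_le_iff_mem _).2 (h3 b r' s' h2))

theorem locallyDirected_iff {R : Type u} [CommRing R] :
    LocallyDirected R ↔ ∀ P : Ideal R, P.IsMaximal → DirectedAt P :=
  ⟨fun h P _ ↦ (isDirectedFamily_localization_iff P).1 (h P),
    fun h P hP ↦ (isDirectedFamily_localization_iff P).2 (h P hP)⟩

/-! ### First properties of RD-flat, RD-injective and RD-coflat modules -/

section Basics

variable {R : Type u} [CommRing R]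

theorem isShortExact_mkQ {M : Type u} [AddCommGroup M] [Module R M] (N : Submodule R M) :
    IsShortExact N.subtype N.mkQ :=
  ⟨N.injective_subtype, LinearMap.exact_subtype_mkQ N, N.mkQ_surjective⟩

theorem isShortExact_lTensor {N M L : Type u} [AddCommGroup N] [Module R N] [AddCommGroup M]
    [Module R M] [AddCommGroup L] [Module R L] {f : N →ₗ[R] M} {g : M →ₗ[R] L}
    (h : IsShortExact f g) (X : Type u) [AddCommGroup X] [Module R X]
    (hinj : Function.Injective (f.lTensor X)) : IsShortExact (f.lTensor X) (g.lTensor X) :=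
  ⟨hinj, lTensor_exact X h.2.1 h.2.2, LinearMap.lTensor_surjective X h.2.2⟩

theorem isRDSubmodule_iff {M : Type u} [AddCommGroup M] [Module R M] {N : Submodule R M} :
    IsRDSubmodule N ↔ ∀ (r : R) (x : M), r • x ∈ N → ∃ y ∈ N, r • x = r • y := by
  constructor
  · intro h r x hx
    have : r • x ∈ r • (⊤ : Submodule R M) ⊓ N := ⟨⟨x, trivial, rfl⟩, hx⟩
    rw [h r] at this
    obtain ⟨y, hy, e⟩ := this
    exact ⟨y, hy, e.symm⟩
  · intro h r
    apply le_antisymm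
    · rintro _ ⟨⟨x, -, rfl⟩, hx⟩
      obtain ⟨y, hy, e⟩ := h r x hx
      exact ⟨y, hy, e.symm⟩
    · rintro _ ⟨y, hy, rfl⟩
      exact ⟨⟨y, trivial, rfl⟩, N.smul_mem r hy⟩

theorem IsRDExact.exists_smul_eq {N M L : Type u} [AddCommGroup N] [Module R N] [AddCommGroup M]
    [Module R M] [AddCommGroup L] [Module R L] {f : N →ₗ[R] M} {g : M →ₗ[R] L}
    (h : IsRDExact f g) (r : R) (x : M) (n : N) (hn : r • x = f n) : ∃ y, n = r • y := by
  obtain ⟨_, ⟨y, rfl⟩, e⟩ := isRDSubmodule_iff.1 h.2 r x ⟨n, hn.symm⟩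
  exact ⟨y, h.1.1 (by rw [map_smul, ← e, hn])⟩

theorem isRDExact_mkQ {M : Type u} [AddCommGroup M] [Module R M] {N : Submodule R M}
    (h : IsRDSubmodule N) : IsRDExact N.subtype N.mkQ :=
  ⟨isShortExact_mkQ N, by rwa [Submodule.range_subtype]⟩

theorem isRDFlat_of_injective {M : Type u} [AddCommGroup M] [Module R M]
    (h : ∀ (N F L : Type u) [AddCommGroup N] [Module R N] [AddCommGroup F] [Module R F]
      [AddCommGroup L] [Module R L] (f : N →ₗ[R] F) (g : F →ₗ[R] L),
      IsRDExact f g → Function.Injective (f.lTensor M)) : IsRDFlat R M :=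
  fun N F L _ _ _ _ _ _ f g hfg ↦ isShortExact_lTensor hfg.1 M (h N F L f g hfg)

theorem isRDInjective_of_extension {M : Type u} [AddCommGroup M] [Module R M]
    (h : ∀ (N F L : Type u) [AddCommGroup N] [Module R N] [AddCommGroup F] [Module R F]
      [AddCommGroup L] [Module R L] (f : N →ₗ[R] F) (g : F →ₗ[R] L),
      IsRDExact f g → ∀ φ : N →ₗ[R] M, ∃ ψ : F →ₗ[R] M, ψ ∘ₗ f = φ) : IsRDInjective R M := by
  intro N F L _ _ _ _ _ _ f g hfg
  refine ⟨?_, ?_, fun φ ↦ h N F L f g hfg φ⟩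
  · intro φ ψ e
    ext l
    obtain ⟨x, rfl⟩ := hfg.1.2.2 l
    exact LinearMap.congr_fun e x
  · intro φ
    constructor
    · intro hφ
      have hk : LinearMap.ker g ≤ LinearMap.ker φ := by
        intro x hx
        obtain ⟨n, rfl⟩ := (hfg.1.2.1 x).1 hx
        exact LinearMap.congr_fun hφ n
      refine ⟨(LinearMap.ker g).liftQ φ hk ∘ₗ
        (LinearMap.quotKerEquivOfSurjective g hfg.1.2.2).symm.toLinearMap, ?_⟩
      ext x
      have : (LinearMap.quotKerEquivOfSurjective g hfg.1.2.2).symm (g x) =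
          (LinearMap.ker g).mkQ x := by
        rw [LinearEquiv.symm_apply_eq]; rfl
      simp [this]
    · rintro ⟨ψ, rfl⟩
      ext n
      simp [hfg.1.2.1.apply_apply_eq_zero n]

theorem IsRDInjective.exists_extension {M : Type u} [AddCommGroup M] [Module R M]
    (h : IsRDInjective R M) {N F L : Type u} [AddCommGroup N] [Module R N] [AddCommGroup F]
    [Module R F] [AddCommGroup L] [Module R L] {f : N →ₗ[R] F} {g : F →ₗ[R] L}
    (hfg : IsRDExact f g) (φ : N →ₗ[R] M) : ∃ ψ : F →ₗ[R] M, ψ ∘ₗ f = φ :=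
  (h N F L f g hfg).2.2 φ

/-- An element killed by `f` stays killed after pushing it to `A` and to `B`, hence vanishes there;
the identity of `M` factors through these two. Only this decomposition of the identity matters, so
the same lemma serves direct sums and isomorphisms. -/
theorem IsRDFlat.of_retracts {M A B : Type u} [AddCommGroup M] [Module R M] [AddCommGroup A]
    [Module R A] [AddCommGroup B] [Module R B] (hA : IsRDFlat R A) (hB : IsRDFlat R B)
    (i : A →ₗ[R] M) (p : M →ₗ[R] A) (j : B →ₗ[R] M) (q : M →ₗ[R] B)
    (h : i ∘ₗ p + j ∘ₗ q = LinearMap.id) : IsRDFlat R M := by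
  refine isRDFlat_of_injective fun N F L _ _ _ _ _ _ f g hfg ↦ ?_
  rw [injective_iff_map_eq_zero]
  intro z hz
  have aux : ∀ {C : Type u} [AddCommGroup C] [Module R C] (_ : IsRDFlat R C) (e : M →ₗ[R] C),
      e.rTensor N z = 0 := by
    intro C _ _ hC e
    apply (hC N F L f g hfg).1
    rw [map_zero, ← LinearMap.comp_apply, LinearMap.lTensor_comp_rTensor,
      ← LinearMap.rTensor_comp_lTensor, LinearMap.comp_apply, hz, map_zero]
  have : z = (i ∘ₗ p + j ∘ₗ q).rTensor N z := by rw [h]; simp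
  rw [this, LinearMap.rTensor_add, LinearMap.add_apply, LinearMap.rTensor_comp,
    LinearMap.rTensor_comp, LinearMap.comp_apply, LinearMap.comp_apply, aux hA p, aux hB q]
  simp

theorem IsRDInjective.of_retracts {M A B : Type u} [AddCommGroup M] [Module R M] [AddCommGroup A]
    [Module R A] [AddCommGroup B] [Module R B] (hA : IsRDInjective R A) (hB : IsRDInjective R B)
    (i : A →ₗ[R] M) (p : M →ₗ[R] A) (j : B →ₗ[R] M) (q : M →ₗ[R] B)
    (h : i ∘ₗ p + j ∘ₗ q = LinearMap.id) : IsRDInjective R M := by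
  refine isRDInjective_of_extension fun N F L _ _ _ _ _ _ f g hfg φ ↦ ?_
  obtain ⟨α, hα⟩ := hA.exists_extension hfg (p ∘ₗ φ)
  obtain ⟨β, hβ⟩ := hB.exists_extension hfg (q ∘ₗ φ)
  refine ⟨i ∘ₗ α + j ∘ₗ β, ?_⟩
  rw [LinearMap.add_comp, LinearMap.comp_assoc, LinearMap.comp_assoc, hα, hβ,
    ← LinearMap.comp_assoc, ← LinearMap.comp_assoc, ← LinearMap.add_comp, h, LinearMap.id_comp]

theorem IsRDFlat.of_equiv {M A : Type u} [AddCommGroup M] [Module R M] [AddCommGroup A]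
    [Module R A] (hA : IsRDFlat R A) (e : A ≃ₗ[R] M) : IsRDFlat R M :=
  hA.of_retracts hA e.toLinearMap e.symm.toLinearMap 0 0 (by ext; simp)

/-- The quotient `R ⧸ I` is RD-flat as soon as `N ∩ IF = IN` for all RD-submodules `N ⊆ F`. -/
theorem isRDFlat_quotient_of_smul_mem {I : Ideal R}
    (h : ∀ (N F L : Type u) [AddCommGroup N] [Module R N] [AddCommGroup F] [Module R F]
      [AddCommGroup L] [Module R L] (f : N →ₗ[R] F) (g : F →ₗ[R] L),
      IsRDExact f g → ∀ n, f n ∈ I • (⊤ : Submodule R F) → n ∈ I • (⊤ : Submodule R N)) :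
    IsRDFlat R (R ⧸ I) := by
  refine isRDFlat_of_injective fun N F L _ _ _ _ _ _ f g hfg ↦ ?_
  rw [injective_iff_map_eq_zero]
  intro z hz
  obtain ⟨n, rfl⟩ : ∃ n : N, z = (Ideal.Quotient.mk I 1) ⊗ₜ n := by
    obtain ⟨y, rfl⟩ := (TensorProduct.quotTensorEquivQuotSMul N I).symm.surjective z
    obtain ⟨n, rfl⟩ := Submodule.mkQ_surjective _ y
    exact ⟨n, by simp⟩
  have hz' := congrArg (TensorProduct.quotTensorEquivQuotSMul F I) hz
  simp only [LinearMap.lTensor_tmul, map_zero] at hz'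
  rw [TensorProduct.quotTensorEquivQuotSMul_mk_tmul, one_smul,
    Submodule.Quotient.mk_eq_zero] at hz'
  apply (TensorProduct.quotTensorEquivQuotSMul N I).injective
  rw [TensorProduct.quotTensorEquivQuotSMul_mk_tmul, one_smul, map_zero,
    Submodule.Quotient.mk_eq_zero]
  exact h N F L f g hfg n hz'

theorem IsRDFlat.mem_smul_top {I : Ideal R} (h : IsRDFlat R (R ⧸ I)) {N F L : Type u}
    [AddCommGroup N] [Module R N] [AddCommGroup F] [Module R F] [AddCommGroup L] [Module R L]
    {f : N →ₗ[R] F} {g : F →ₗ[R] L} (hfg : IsRDExact f g) {n : N}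
    (hn : f n ∈ I • (⊤ : Submodule R F)) : n ∈ I • (⊤ : Submodule R N) := by
  have hz : f.lTensor (R ⧸ I) ((Ideal.Quotient.mk I 1) ⊗ₜ n) = 0 := by
    apply (TensorProduct.quotTensorEquivQuotSMul F I).injective
    rw [LinearMap.lTensor_tmul, TensorProduct.quotTensorEquivQuotSMul_mk_tmul, one_smul, map_zero,
      Submodule.Quotient.mk_eq_zero]
    exact hn
  have h0 := (h N F L f g hfg).1 (hz.trans (map_zero _).symm)
  have h1 := congrArg (TensorProduct.quotTensorEquivQuotSMul N I) h0
  rwa [TensorProduct.quotTensorEquivQuotSMul_mk_tmul, one_smul, map_zero,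
    Submodule.Quotient.mk_eq_zero] at h1

end Basics

/-! ### Implications between the conditions, and necessity of directedness via coflatness -/

section Implications

variable {R : Type u} [CommRing R]

/-- A tensor involves finitely many elements of `X`, and its vanishing over `F` is already visible
in a larger finitely generated submodule. -/
theorem lTensor_injective_of_fg {N F : Type u} [AddCommGroup N] [Module R N] [AddCommGroup F]
    [Module R F] (f : N →ₗ[R] F) (X : Type u) [AddCommGroup X] [Module R X]
    (h : ∀ Y : Submodule R X, Y.FG → Function.Injective (f.lTensor Y)) :
    Function.Injective (f.lTensor X) := by
  rw [injective_iff_map_eq_zero]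
  intro z hz
  obtain ⟨Y, hY, y, rfl⟩ := Submodule.exists_fg_le_eq_rTensor_subtype z
  rw [← LinearMap.comp_apply, LinearMap.lTensor_comp_rTensor, ← LinearMap.rTensor_comp_lTensor,
    LinearMap.comp_apply, ← map_zero (Y.subtype.rTensor F)] at hz
  obtain ⟨Z, hZ, hYZ, e⟩ := hY.exists_rTensor_fg_inclusion_eq hz
  rw [map_zero, ← LinearMap.comp_apply, LinearMap.rTensor_comp_lTensor,
    ← LinearMap.lTensor_comp_rTensor, LinearMap.comp_apply] at e
  have h0 := (injective_iff_map_eq_zero _).1 (h Z hZ) _ e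
  have : Y.subtype = Z.subtype ∘ₗ Submodule.inclusion hYZ := rfl
  rw [this, LinearMap.rTensor_comp, LinearMap.comp_apply, h0, map_zero]

theorem isRDFlat_of_isArtinian
    (h : ∀ (M : Type u) [AddCommGroup M] [Module R M], IsFiniteLength R M → IsRDFlat R M)
    (M : Type u) [AddCommGroup M] [Module R M] [IsArtinian R M] : IsRDFlat R M := by
  refine isRDFlat_of_injective fun N F L _ _ _ _ _ _ f g hfg ↦ ?_
  refine lTensor_injective_of_fg f M fun Y hY ↦ ?_
  have : Module.Finite R Y := Module.Finite.iff_fg.2 hY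
  have : IsNoetherian R Y := isNoetherian_of_finite_isArtinian _
  exact (h Y (isFiniteLength_iff_isNoetherian_isArtinian.2 ⟨inferInstance, inferInstance⟩)
    N F L f g hfg).1

/-- Evaluation on a finite generating set embeds `R ⧸ ann M` into a finite power of `M`. -/
theorem isNoetherianRing_quotient_annihilator (M : Type u) [AddCommGroup M] [Module R M]
    [IsNoetherian R M] : IsNoetherianRing (R ⧸ Module.annihilator R M) := by
  obtain ⟨s, hs⟩ := IsNoetherian.noetherian (⊤ : Submodule R M)
  let φ : R →ₗ[R] (s → M) := LinearMap.pi fun m ↦ LinearMap.toSpanSingleton R M m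
  have hφ : LinearMap.ker φ = Module.annihilator R M := by
    ext r
    rw [LinearMap.mem_ker, ← Submodule.annihilator_top, ← hs, Submodule.mem_annihilator_span]
    constructor
    · exact fun h m ↦ congrFun h m
    · exact fun h ↦ funext fun m ↦ h m
  have h1 : IsNoetherian R (R ⧸ LinearMap.ker φ) :=
    isNoetherian_of_linearEquiv φ.quotKerEquivRange.symm
  have h2 : IsNoetherian R (R ⧸ Module.annihilator R M) := hφ ▸ h1
  exact isNoetherian_of_tower R h2

/-- A nonzero element of a noetherian module is nonzero modulo some power of a maximal ideal. -/
theorem exists_maximal_notMem_pow_smul_top {Y : Type u} [AddCommGroup Y] [Module R Y]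
    [IsNoetherian R Y] {z : Y} (hz : z ≠ 0) :
    ∃ (P : Ideal R) (n : ℕ), P.IsMaximal ∧ z ∉ P ^ n • (⊤ : Submodule R Y) := by
  have hne : Ideal.torsionOf R Y z ≠ ⊤ := by simpa using hz
  obtain ⟨P, hP, hle⟩ := Ideal.exists_le_maximal _ hne
  by_contra! hcon
  have hmem : ∀ n, z ∈ P ^ n • (⊤ : Submodule R Y) := fun n ↦ hcon P n hP
  let A := R ⧸ Module.annihilator R Y
  let _ : Module A Y := Module.quotientAnnihilator
  have : IsScalarTower R A Y := ⟨fun r a y ↦ by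
    obtain ⟨a, rfl⟩ := Ideal.Quotient.mk_surjective a
    rw [← Ideal.Quotient.mk_eq_mk, ← Submodule.Quotient.mk_smul]
    exact mul_smul r a y⟩
  have hAY : IsNoetherian A Y := isNoetherian_of_tower R inferInstance
  have hA : IsNoetherianRing A := isNoetherianRing_quotient_annihilator _
  have hle' : ∀ n, ∀ y ∈ P ^ n • (⊤ : Submodule R Y),
      y ∈ (P.map (Ideal.Quotient.mk (Module.annihilator R Y))) ^ n • (⊤ : Submodule A Y) := by
    intro n y hy
    refine Submodule.smul_induction_on hy ?_ (fun _ _ ↦ Submodule.add_mem _)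
    intro r hr y _
    have : r • y = (Ideal.Quotient.mk (Module.annihilator R Y) r : A) • y := rfl
    rw [this]
    refine Submodule.smul_mem_smul ?_ trivial
    rw [← Ideal.map_pow]
    exact Ideal.mem_map_of_mem _ hr
  -- By Krull's theorem some `p ∈ P` satisfies `p • z = z`. Then `1 - p` kills `z`, hence lies in
  -- `P` by the choice of `P`, which is absurd.
  obtain ⟨⟨r, hr⟩, e⟩ := (Ideal.mem_iInf_smul_pow_eq_bot_iff
    (P.map (Ideal.Quotient.mk (Module.annihilator R Y))) z).1
      ((Submodule.mem_iInf _).2 fun n ↦ hle' n z (hmem n))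
  obtain ⟨p, hp, rfl⟩ := (Ideal.mem_map_iff_of_surjective _ Ideal.Quotient.mk_surjective).1 hr
  have e' : p • z = z := e
  have h1 : 1 - p ∈ P := hle (by
    rw [Ideal.mem_torsionOf_iff, sub_smul, one_smul, e', sub_self])
  exact hP.ne_top ((Ideal.eq_top_iff_one P).2 (by simpa using P.add_mem h1 hp))

/-- Every prime containing the annihilator contains `P ^ n`, so it is `P`. Thus `R ⧸ ann M` is
noetherian of dimension zero, hence artinian. -/
theorem isFiniteLength_of_pow_smul_eq_bot {M : Type u} [AddCommGroup M] [Module R M]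
    [IsNoetherian R M] {P : Ideal R} [hP : P.IsMaximal] {n : ℕ}
    (h : P ^ n • (⊤ : Submodule R M) = ⊥) : IsFiniteLength R M := by
  let A := R ⧸ Module.annihilator R M
  let _ : Module A M := Module.quotientAnnihilator
  have : IsScalarTower R A M := ⟨fun r a y ↦ by
    obtain ⟨a, rfl⟩ := Ideal.Quotient.mk_surjective a
    rw [← Ideal.Quotient.mk_eq_mk, ← Submodule.Quotient.mk_smul]
    exact mul_smul r a y⟩
  have hAY : IsNoetherian A M := isNoetherian_of_tower R inferInstance
  have hA : IsNoetherianRing A := isNoetherianRing_quotient_annihilator _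
  have hle : P ^ n ≤ Module.annihilator R M := fun r hr ↦ Module.mem_annihilator.2 fun m ↦ by
    have : r • m ∈ P ^ n • (⊤ : Submodule R M) := Submodule.smul_mem_smul hr trivial
    rwa [h] at this
  have hdim : Ring.KrullDimLE 0 A := by
    rw [Ring.krullDimLE_zero_iff]
    intro I hI
    have h1 : P ≤ I.comap (Ideal.Quotient.mk (Module.annihilator R M)) := by
      refine Ideal.IsPrime.le_of_pow_le (n := n) (hle.trans ?_)
      intro r hr
      rw [Ideal.mem_comap, Ideal.Quotient.eq_zero_iff_mem.2 hr]
      exact I.zero_mem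
    have h2 := hP.eq_of_le (Ideal.IsPrime.ne_top inferInstance) h1
    have : (I.comap (Ideal.Quotient.mk (Module.annihilator R M))).IsMaximal := h2 ▸ hP
    rw [← Ideal.map_comap_of_surjective _ Ideal.Quotient.mk_surjective I]
    refine Ideal.IsMaximal.map_of_surjective_of_ker_le Ideal.Quotient.mk_surjective ?_
    exact Ideal.comap_mono bot_le
  have : IsArtinianRing A := isArtinianRing_iff_isNoetherianRing_krullDimLE_zero.2 ⟨hA, hdim⟩
  have hAM : IsArtinian A M := inferInstance
  have : IsArtinian R M := isArtinian_of_surjective_algebraMap (R := A)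
    Ideal.Quotient.mk_surjective
  exact isFiniteLength_iff_isNoetherian_isArtinian.2 ⟨inferInstance, inferInstance⟩

theorem isNoetherian_tensorProduct (Y M : Type u) [AddCommGroup Y] [Module R Y]
    [AddCommGroup M] [Module R M] [Module.Finite R Y] [IsNoetherian R M] :
    IsNoetherian R (Y ⊗[R] M) := by
  obtain ⟨n, φ, hφ⟩ := Module.Finite.exists_fin' R Y
  have : IsNoetherian R (M ⊗[R] (Fin n → R)) :=
    isNoetherian_of_linearEquiv (TensorProduct.piScalarRight R R M (Fin n)).symm
  have : IsNoetherian R ((Fin n → R) ⊗[R] M) :=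
    isNoetherian_of_linearEquiv (TensorProduct.comm R M (Fin n → R))
  exact isNoetherian_of_surjective (φ.rTensor M)
    (LinearMap.range_eq_top.2 (LinearMap.rTensor_surjective M hφ))

/-- A noetherian module is RD-coflat if all modules of finite length are RD-injective. -/
theorem isRDCoflat_of_isNoetherian
    (h : ∀ (M : Type u) [AddCommGroup M] [Module R M], IsFiniteLength R M → IsRDInjective R M)
    (M : Type u) [AddCommGroup M] [Module R M] [IsNoetherian R M] : IsRDCoflat R M := by
  intro F L _ _ _ _ f g hfg
  refine ⟨hfg.1, fun X _ _ ↦ isShortExact_lTensor hfg.1 X ?_⟩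
  refine lTensor_injective_of_fg f X fun Y hY ↦ ?_
  have : Module.Finite R Y := Module.Finite.iff_fg.2 hY
  have : IsNoetherian R (Y ⊗[R] M) := isNoetherian_tensorProduct Y M
  rw [injective_iff_map_eq_zero]
  intro z hz
  by_contra hne
  obtain ⟨P, n, hP, hzP⟩ := exists_maximal_notMem_pow_smul_top (R := R) hne
  have hfl : IsFiniteLength R (M ⧸ P ^ n • (⊤ : Submodule R M)) := by
    refine isFiniteLength_of_pow_smul_eq_bot (P := P) (n := n) ?_
    rw [← Submodule.range_mkQ (P ^ n • (⊤ : Submodule R M)), LinearMap.range_eq_map,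
      ← Submodule.map_smul'', Submodule.mkQ_map_self]
  -- The projection of `M` onto `M ⧸ P ^ n M` extends to `F`, so an element that dies in `Y ⊗ F`
  -- dies in `Y ⊗ (M ⧸ P ^ n M)` and therefore lies in `P ^ n (Y ⊗ M)`.
  obtain ⟨ψ, hψ⟩ := (h _ hfl).exists_extension hfg (P ^ n • (⊤ : Submodule R M)).mkQ
  have hz' : (P ^ n • (⊤ : Submodule R M)).mkQ.lTensor Y z = 0 := by
    rw [← hψ, LinearMap.lTensor_comp, LinearMap.comp_apply, hz, map_zero]
  obtain ⟨w, rfl⟩ := ((lTensor_exact Y (LinearMap.exact_subtype_mkQ _)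
    (Submodule.mkQ_surjective (P ^ n • (⊤ : Submodule R M)))) z).1 hz'
  apply hzP
  clear hzP hz' hz hne
  induction w with
  | zero => simp
  | add a b ha hb => rw [map_add]; exact Submodule.add_mem _ ha hb
  | tmul y m =>
    obtain ⟨m, hm⟩ := m
    rw [LinearMap.lTensor_tmul]
    change y ⊗ₜ m ∈ _
    refine Submodule.smul_induction_on hm ?_ ?_
    · intro r hr x _
      rw [TensorProduct.tmul_smul]
      exact Submodule.smul_mem_smul hr trivial
    · intro a b ha hb
      rw [TensorProduct.tmul_add]
      exact Submodule.add_mem _ ha hb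

/-- If `n ∉ PN`, some linear functional on the vector space `N ⧸ PN` is nonzero at `n`. An extension
of it to `F` kills `PF`, so `f n ∉ PF`. -/
theorem isRDFlat_quotient_of_isRDInjective {P : Ideal R} [hP : P.IsMaximal]
    (h : IsRDInjective R (R ⧸ P)) : IsRDFlat R (R ⧸ P) := by
  refine isRDFlat_quotient_of_smul_mem fun N F L _ _ _ _ _ _ f g hfg n hn ↦ ?_
  by_contra hcon
  let _ : Field (R ⧸ P) := Ideal.Quotient.field P
  have h0 : (P • (⊤ : Submodule R N)).mkQ n ≠ 0 := fun h0 ↦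
    hcon ((Submodule.Quotient.mk_eq_zero _).1 h0)
  obtain ⟨φ, hφ⟩ : ∃ φ : Module.Dual (R ⧸ P) (N ⧸ P • (⊤ : Submodule R N)),
      φ ((P • (⊤ : Submodule R N)).mkQ n) ≠ 0 := by
    by_contra! hall
    exact h0 ((Module.forall_dual_apply_eq_zero_iff (R ⧸ P) _).1 hall)
  obtain ⟨ψ, hψ⟩ := h.exists_extension hfg
    (φ.restrictScalars R ∘ₗ (P • (⊤ : Submodule R N)).mkQ)
  apply hφ
  have h1 : ψ (f n) = φ ((P • (⊤ : Submodule R N)).mkQ n) := LinearMap.congr_fun hψ n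
  rw [← h1]
  refine Submodule.smul_induction_on hn ?_ ?_
  · intro r hr x _
    obtain ⟨y, hy⟩ := Ideal.Quotient.mk_surjective (ψ x)
    rw [map_smul, ← hy, ← Ideal.Quotient.mk_eq_mk, ← Submodule.Quotient.mk_smul,
      Submodule.Quotient.mk_eq_zero]
    exact P.mul_mem_right _ hr
  · intro a b ha hb
    rw [map_add, ha, hb, add_zero]

/-- If `R ⧸ P` is RD-coflat, then `DirectedAt P` holds: otherwise `1 ↦ (a, b)` embeds `R ⧸ P` into
`R² ⧸ P(a, b)` as a relatively divisible submodule that is not pure. -/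
theorem directedAt_of_isRDCoflat {P : Ideal R} [hP : P.IsMaximal]
    (h : IsRDCoflat R (R ⧸ P)) : DirectedAt P := by
  by_contra hcon
  unfold DirectedAt at hcon
  push Not at hcon
  obtain ⟨a, ha, b, hb, hab⟩ := hcon
  let K : Submodule R (R × R) := P • Submodule.span R {(a, b)}
  have hK : ∀ v, v ∈ K ↔ ∃ q ∈ P, q • (a, b) = v := fun v ↦ Submodule.mem_smul_span_singleton
  let f : R ⧸ P →ₗ[R] (R × R) ⧸ K := P.liftQ (LinearMap.toSpanSingleton R _ (K.mkQ (a, b))) (by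
    intro q hq
    rw [LinearMap.mem_ker, LinearMap.toSpanSingleton_apply, ← map_smul]
    exact (Submodule.Quotient.mk_eq_zero _).2 ((hK _).2 ⟨q, hq, rfl⟩))
  have hf : ∀ d : R, f (Ideal.Quotient.mk P d) = K.mkQ (d • (a, b)) := by
    intro d
    rw [map_smul]
    exact Submodule.liftQ_apply _ _ _
  have hinj : Function.Injective f := by
    rw [injective_iff_map_eq_zero]
    intro x hx
    obtain ⟨d, rfl⟩ := Ideal.Quotient.mk_surjective x
    rw [hf] at hx
    obtain ⟨q, hq, e⟩ := (hK _).1 ((Submodule.Quotient.mk_eq_zero _).1 hx)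
    rw [Ideal.Quotient.eq_zero_iff_mem]
    by_contra hd
    simp only [Prod.smul_mk, smul_eq_mul, Prod.mk.injEq] at e
    -- Here `d - q ∉ P` kills both `a` and `b`, so `0` would be a local common divisor.
    refine hab 0 P.zero_mem (d - q) (fun hdq ↦ hd (by simpa using P.add_mem hdq hq)) 0 0 ?_ ?_
    · rw [sub_mul, e.1]; ring
    · rw [sub_mul, e.2]; ring
  have hRD : IsRDExact f (LinearMap.range f).mkQ := by
    refine ⟨⟨hinj, LinearMap.exact_map_mkQ_range f, Submodule.mkQ_surjective _⟩, ?_⟩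
    rw [isRDSubmodule_iff]
    rintro r x ⟨n, hn⟩
    obtain ⟨d, rfl⟩ := Ideal.Quotient.mk_surjective n
    obtain ⟨⟨v, w⟩, rfl⟩ := K.mkQ_surjective x
    by_cases hr : r ∈ P
    · rw [hf, ← map_smul, ← sub_eq_zero, ← map_sub] at hn
      obtain ⟨q, hq, e⟩ := (hK _).1 ((Submodule.Quotient.mk_eq_zero _).1 hn)
      simp only [Prod.smul_mk, smul_eq_mul, Prod.mk_sub_mk, Prod.mk.injEq] at e
      have hd : d ∈ P := by
        by_contra hd
        -- If `d ∉ P`, the equality `(d - q)(a, b) = r(v, w)` makes `r` a local common divisor of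
        -- `a` and `b`. Hence `d ∈ P`, and `r • x` is zero.
        refine hab r hr (d - q) (fun hdq ↦ hd (by simpa using P.add_mem hdq hq)) v w ?_ ?_
        · rw [sub_mul, e.1]; ring
        · rw [sub_mul, e.2]; ring
      refine ⟨0, Submodule.zero_mem _, ?_⟩
      rw [← map_smul, smul_zero, ← sub_eq_zero, sub_zero]
      refine (Submodule.Quotient.mk_eq_zero _).2 ((hK _).2 ⟨d - q, P.sub_mem hd hq, ?_⟩)
      simp only [Prod.smul_mk, smul_eq_mul, Prod.mk.injEq]
      constructor
      · rw [sub_mul, e.1]; ring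
      · rw [sub_mul, e.2]; ring
    · obtain ⟨s, hs⟩ := Ideal.Quotient.exists_inv (I := P) (a := Ideal.Quotient.mk P r)
        (fun h0 ↦ hr (Ideal.Quotient.eq_zero_iff_mem.1 h0))
      obtain ⟨s, rfl⟩ := Ideal.Quotient.mk_surjective s
      refine ⟨f (Ideal.Quotient.mk P (s * d)), ⟨_, rfl⟩, ?_⟩
      rw [← hn, ← map_smul]
      congr 1
      rw [Algebra.smul_def, Ideal.Quotient.algebraMap_eq, map_mul, ← mul_assoc, hs, one_mul]
  -- Tensoring with `R ⧸ (a, b)` kills the image of `1 ⊗ 1`, whereas `R ⧸ (a, b) ⊗ R ⧸ P` is `R ⧸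
  -- P`, because `a, b ∈ P`.
  have hpure := (h _ _ _ _ hRD).2 (R ⧸ Ideal.span {a, b})
  have hz : f.lTensor (R ⧸ Ideal.span {a, b}) (Ideal.Quotient.mk _ 1 ⊗ₜ Ideal.Quotient.mk P 1) =
      0 := by
    have : (1 : R) • (a, b) = a • ((1 : R), (0 : R)) + b • ((0 : R), (1 : R)) := by simp
    rw [LinearMap.lTensor_tmul, hf, this, map_add, map_smul, map_smul, TensorProduct.tmul_add,
      ← TensorProduct.smul_tmul, ← TensorProduct.smul_tmul]
    have hmem : ∀ x ∈ Ideal.span {a, b}, x • (Ideal.Quotient.mk (Ideal.span {a, b}) 1) = 0 := by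
      intro x hx
      rw [← Ideal.Quotient.mk_eq_mk, ← Submodule.Quotient.mk_smul, Submodule.Quotient.mk_eq_zero]
      exact Ideal.mul_mem_right _ _ hx
    rw [hmem a (Ideal.subset_span (by simp)), hmem b (Ideal.subset_span (by simp))]
    simp
  have h0 := hpure.1 (hz.trans (map_zero _).symm)
  have h1 := congrArg (TensorProduct.quotTensorEquivQuotSMul (R ⧸ P) (Ideal.span {a, b})) h0
  rw [TensorProduct.quotTensorEquivQuotSMul_mk_tmul, one_smul, map_zero,
    Submodule.Quotient.mk_eq_zero] at h1
  have h2 : Ideal.span {a, b} • (⊤ : Submodule R (R ⧸ P)) ≤ ⊥ := by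
    refine Submodule.smul_le.2 fun x hx y _ ↦ ?_
    have hxP : x ∈ P := (Ideal.span_le.2 (by
      rintro y (rfl | rfl)
      · exact ha
      · exact hb) : Ideal.span {a, b} ≤ P) hx
    obtain ⟨y, rfl⟩ := Ideal.Quotient.mk_surjective y
    rw [← Ideal.Quotient.mk_eq_mk, ← Submodule.Quotient.mk_smul, Submodule.mem_bot,
      Submodule.Quotient.mk_eq_zero]
    exact P.mul_mem_right _ hxP
  have h3 : Ideal.Quotient.mk P 1 = 0 := h2 h1
  exact hP.ne_top ((Ideal.eq_top_iff_one P).2 (Ideal.Quotient.eq_zero_iff_mem.1 h3))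

end Implications

/-! ### Necessity of directedness via flatness -/

section Cover

open scoped DirectSum

variable {R : Type u} [CommRing R]

/-- Relations `r • v ∈ R(a, b)`: the index set of an RD-cover of `R² ⧸ R(a, b)`. -/
abbrev PairRelation (a b : R) : Type u :=
  {x : R × (R × R) × R // x.1 • x.2.1 = x.2.2 • (a, b)}

/-- If `R ⧸ P` is RD-flat then `DirectedAt P` holds. The condition is tested on the kernel of a
cover of `R² ⧸ R(a, b)` by a direct sum of cyclically presented modules. -/
theorem directedAt_of_isRDFlat {P : Ideal R} [hP : P.IsMaximal]
    (h : IsRDFlat R (R ⧸ P)) : DirectedAt P := by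
  classical
  intro a ha b hb
  let J := PairRelation a b
  let D := ⨁ j : J, R ⧸ Ideal.span {j.1.1}
  let U : Submodule R (R × R) := Submodule.span R {(a, b)}
  have hU : ∀ j : J, j.1.1 • U.mkQ j.1.2.1 = 0 := by
    intro j
    rw [← map_smul, j.2]
    exact (Submodule.Quotient.mk_eq_zero _).2 (Submodule.smul_mem _ _ (Submodule.subset_span rfl))
  let ρ : D →ₗ[R] (R × R) ⧸ U := DirectSum.toModule R J _ fun j ↦
    (Ideal.span {j.1.1}).liftQ (LinearMap.toSpanSingleton R _ (U.mkQ j.1.2.1)) (by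
      rw [Ideal.span_le, Set.singleton_subset_iff]
      exact hU j)
  let π : (R × R) × D →ₗ[R] (R × R) ⧸ U := U.mkQ.coprod ρ
  let Z : (J →₀ R) →ₗ[R] D := Finsupp.lsum R fun j ↦
    (DirectSum.lof R J (fun j ↦ R ⧸ Ideal.span {j.1.1}) j) ∘ₗ (Ideal.span {j.1.1}).mkQ
  let Λ : (J →₀ R) →ₗ[R] R × R := Finsupp.linearCombination R fun j ↦ j.1.2.1
  have hZs : ∀ j x, Z (Finsupp.single j x) = DirectSum.lof R J _ j (Ideal.Quotient.mk _ x) := by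
    intro j x
    simp [Z]
  have hρZ : ∀ z, ρ (Z z) = U.mkQ (Λ z) := by
    intro z
    rw [← LinearMap.comp_apply, ← LinearMap.comp_apply]
    congr 1
    refine Finsupp.lhom_ext fun j x ↦ ?_
    rw [LinearMap.comp_apply, LinearMap.comp_apply, hZs, DirectSum.toModule_lof,
      Finsupp.linearCombination_single, map_smul]
    exact Submodule.liftQ_apply _ _ _
  have hZ : Function.Surjective Z := by
    intro d
    induction d using DirectSum.induction_on with
    | zero => exact ⟨0, map_zero _⟩
    | of j x =>
      obtain ⟨x, rfl⟩ := Ideal.Quotient.mk_surjective x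
      exact ⟨Finsupp.single j x, hZs j x⟩
    | add x y hx hy =>
      obtain ⟨x, rfl⟩ := hx
      obtain ⟨y, rfl⟩ := hy
      exact ⟨x + y, map_add _ _ _⟩
  have hπ : ∀ v z, π (v, Z z) = U.mkQ (v + Λ z) := by
    intro v z
    rw [LinearMap.coprod_apply, hρZ, map_add]
  let N := LinearMap.ker π
  have hRD : IsRDSubmodule N := by
    rw [isRDSubmodule_iff]
    intro r x hx
    obtain ⟨v, hv⟩ := U.mkQ_surjective (π x)
    have hrv : r • v ∈ U := by
      rw [← Submodule.Quotient.mk_eq_zero, ← Submodule.mkQ_apply, map_smul, hv, ← map_smul]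
      exact hx
    obtain ⟨d, hd⟩ := Submodule.mem_span_singleton.1 hrv
    -- The generator of the summand indexed by this relation has the same image as `x` and is killed
    -- by `r`; subtracting it from `x` gives the element of `N` required by relative divisibility.
    let j : J := ⟨(r, v, d), hd.symm⟩
    have h1 : r • Z (Finsupp.single j 1) = 0 := by
      rw [hZs, ← map_smul, ← Ideal.Quotient.mk_eq_mk, ← Submodule.Quotient.mk_smul,
        (Submodule.Quotient.mk_eq_zero _).2, map_zero]
      exact Ideal.mul_mem_right _ _ (Ideal.mem_span_singleton_self _)
    refine ⟨x - (0, Z (Finsupp.single j 1)), ?_, ?_⟩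
    · rw [LinearMap.mem_ker, map_sub, hπ, ← hv, zero_add, Finsupp.linearCombination_single,
        one_smul, sub_self]
    · have h2 : r • ((0 : R × R), Z (Finsupp.single j 1)) = 0 := Prod.ext (smul_zero _) h1
      rw [smul_sub, h2, sub_zero]
  let n : N := ⟨((a, b), 0), by
    have := hπ (a, b) 0
    rw [map_zero, map_zero, add_zero] at this
    rw [LinearMap.mem_ker, this]
    exact (Submodule.Quotient.mk_eq_zero _).2 (Submodule.subset_span rfl)⟩
  have hn : N.subtype n ∈ P • (⊤ : Submodule R ((R × R) × D)) := by
    have : N.subtype n = a • (((1 : R), (0 : R)), (0 : D)) + b • (((0 : R), (1 : R)), (0 : D)) := by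
      simp [n]
    rw [this]
    exact Submodule.add_mem _ (Submodule.smul_mem_smul ha trivial)
      (Submodule.smul_mem_smul hb trivial)
  -- An element of `PN` can be lifted with all coefficients `z j` in `P`, and with its defect along
  -- `(a, b)` in `P` too.
  have key : ∀ y ∈ P • (⊤ : Submodule R N), ∃ z : J →₀ R, (∀ j, z j ∈ P) ∧ ∃ s ∈ P,
      (y : (R × R) × D).2 = Z z ∧ (y : (R × R) × D).1 + Λ z = s • (a, b) := by
    intro y hy
    refine Submodule.smul_induction_on hy ?_ ?_
    · rintro p hp ⟨⟨v, d⟩, hx⟩ _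
      obtain ⟨z, rfl⟩ := hZ d
      rw [LinearMap.mem_ker, hπ] at hx
      obtain ⟨s, hs⟩ := Submodule.mem_span_singleton.1 ((Submodule.Quotient.mk_eq_zero _).1 hx)
      refine ⟨p • z, fun j ↦ P.mul_mem_right _ hp, p * s, P.mul_mem_right _ hp, ?_, ?_⟩
      · exact (map_smul _ _ _).symm
      · change p • v + Λ (p • z) = _
        rw [map_smul, ← smul_add, ← hs, smul_smul]
    · rintro x y ⟨z, hz, s, hs, e1, e2⟩ ⟨z', hz', s', hs', e1', e2'⟩
      refine ⟨z + z', fun j ↦ P.add_mem (hz j) (hz' j), s + s', P.add_mem hs hs', ?_, ?_⟩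
      · rw [map_add, ← e1, ← e1']; rfl
      · rw [map_add, add_smul, ← e2, ← e2']
        change (x : (R × R) × D).1 + (y : (R × R) × D).1 + _ = _
        abel
  obtain ⟨z, hz, s, hs, e1, e2⟩ := key n (h.mem_smul_top (isRDExact_mkQ hRD) hn)
  change 0 = Z z at e1
  change (a, b) + Λ z = s • (a, b) at e2
  have hzj : ∀ j : J, ∃ w, z j = w * j.1.1 := by
    intro j
    have h1 : DirectSum.component R J (fun j ↦ R ⧸ Ideal.span {j.1.1}) j (Z z) =
        Ideal.Quotient.mk _ (z j) := by
      clear e1 e2 hz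
      induction z using Finsupp.induction_linear with
      | zero => simp
      | add x y hx hy => rw [map_add, map_add, hx, hy, Finsupp.add_apply, map_add]
      | single i x =>
        rw [hZs]
        by_cases hij : i = j
        · subst hij
          rw [DirectSum.component.lof_self, Finsupp.single_eq_same]
        · rw [DirectSum.component.of, dif_neg hij, Finsupp.single_eq_of_ne (Ne.symm hij), map_zero]
    rw [← e1, map_zero] at h1
    obtain ⟨w, hw⟩ := Ideal.mem_span_singleton'.1 (Ideal.Quotient.eq_zero_iff_mem.1 h1.symm)
    exact ⟨w, hw.symm⟩
  choose w hw using hzj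
  -- Since `Z z = 0`, each `z j` equals `w j * r` for the divisor `r` of relation `j`. If `w j * d ∉
  -- P` for some `j`, then `r ∈ P` and `d ∉ P`, so the relation `r • v = d • (a, b)` itself provides
  -- the common divisor. Otherwise a scalar congruent to `1` modulo `P` kills `(a, b)`, and `c = 0`
  -- works.
  by_cases hcase : ∃ j : J, w j * j.1.2.2 ∉ P
  · obtain ⟨⟨⟨r, ⟨x, y⟩, d⟩, hj⟩, hwd⟩ := hcase
    simp only [Prod.smul_mk, smul_eq_mul, Prod.mk.injEq] at hj hwd
    have h1 := hw ⟨(r, (x, y), d), by simp [hj]⟩ ▸ hz ⟨(r, (x, y), d), by simp [hj]⟩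
    refine ⟨r, ?_, d, fun hd ↦ hwd (P.mul_mem_left _ hd), x, y, ?_, ?_⟩
    · exact (hP.isPrime.mem_or_mem h1).resolve_left fun h2 ↦ hwd (P.mul_mem_right _ h2)
    · rw [← hj.1, mul_comm]
    · rw [← hj.2, mul_comm]
  · push Not at hcase
    have hΛ : Λ z = (∑ j ∈ z.support, w j * j.1.2.2) • (a, b) := by
      rw [Finsupp.linearCombination_apply, Finsupp.sum, Finset.sum_smul]
      refine Finset.sum_congr rfl fun j _ ↦ ?_
      rw [hw j, mul_smul, j.2, smul_smul]
    have hq : ∑ j ∈ z.support, w j * j.1.2.2 ∈ P := P.sum_mem fun j _ ↦ hcase j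
    rw [hΛ] at e2
    simp only [Prod.smul_mk, smul_eq_mul, Prod.mk_add_mk, Prod.mk.injEq] at e2
    refine ⟨0, P.zero_mem, 1 - s + ∑ j ∈ z.support, w j * j.1.2.2, fun ht ↦ ?_, 0, 0, ?_, ?_⟩
    · refine hP.ne_top ((Ideal.eq_top_iff_one P).2 ?_)
      have := P.add_mem (P.sub_mem ht hq) hs
      simpa using this
    · linear_combination e2.1
    · linear_combination e2.2

end Cover

/-! ### Decompositions into indecomposable elements of a modular lattice -/

section Lattice

variable {α : Type*} [Lattice α] [OrderBot α]

/-- An element of a lattice is indecomposable if it is not the supremum of two disjoint nonzero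
elements. -/
def Indecomposable (a : α) : Prop := ∀ b c, Disjoint b c → b ⊔ c = a → b = ⊥ ∨ c = ⊥

theorem lt_sup_of_disjoint_of_ne_bot {b c : α} (h : Disjoint b c) (hc : c ≠ ⊥) : b < b ⊔ c :=
  lt_of_le_of_ne le_sup_left fun e ↦ hc (h.eq_bot_of_ge (sup_eq_left.1 e.symm))

theorem induction_indecomposable_of_wellFoundedLT [WellFoundedLT α] (C : α → Prop)
    (indec : ∀ a, Indecomposable a → C a)
    (sup : ∀ a b, Disjoint a b → C a → C b → C (a ⊔ b)) (a : α) : C a := by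
  induction a using WellFoundedLT.induction with
  | ind a ih =>
    by_cases ha : Indecomposable a
    · exact indec a ha
    · unfold Indecomposable at ha
      push Not at ha
      obtain ⟨b, c, hbc, rfl, hb, hc⟩ := ha
      exact sup b c hbc (ih b (lt_sup_of_disjoint_of_ne_bot hbc hc))
        (ih c (sup_comm b c ▸ lt_sup_of_disjoint_of_ne_bot hbc.symm hb))

/-- Under the ascending chain condition the induction runs on an element `d` disjoint from `a`: when
`a` splits as `b ⊔ c`, the piece `b` is disjoint from the strictly larger `d ⊔ c`, by modularity. -/
theorem induction_indecomposable_of_wellFoundedGT [IsModularLattice α] [WellFoundedGT α]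
    (C : α → Prop) (indec : ∀ a, Indecomposable a → C a)
    (sup : ∀ a b, Disjoint a b → C a → C b → C (a ⊔ b)) (a : α) : C a := by
  suffices h : ∀ d a : α, Disjoint d a → C a from h ⊥ a disjoint_bot_left
  intro d
  induction d using WellFoundedGT.induction with
  | ind d ih =>
    intro a hda
    by_cases ha : Indecomposable a
    · exact indec a ha
    · unfold Indecomposable at ha
      push Not at ha
      obtain ⟨b, c, hbc, rfl, hb, hc⟩ := ha
      refine sup b c hbc
        (ih (d ⊔ c) (lt_sup_of_disjoint_of_ne_bot (hda.mono_right le_sup_right) hc) b ?_)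
        (ih (d ⊔ b) (lt_sup_of_disjoint_of_ne_bot (hda.mono_right le_sup_left) hb) c ?_)
      · exact hbc.symm.disjoint_sup_left_of_disjoint_sup_right (sup_comm b c ▸ hda)
      · exact hbc.disjoint_sup_left_of_disjoint_sup_right hda

/-- `a` is the supremum of a finite independent family of indecomposable elements. -/
def HasIndecomposableDecomposition [DecidableEq α] (a : α) : Prop :=
  ∃ s : Finset α, s.SupIndep id ∧ s.sup id = a ∧ ∀ b ∈ s, Indecomposable b

theorem Indecomposable.hasIndecomposableDecomposition [DecidableEq α] {a : α}
    (h : Indecomposable a) : HasIndecomposableDecomposition a :=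
  ⟨{a}, Finset.supIndep_singleton _ _, by simp, by simpa using h⟩

theorem HasIndecomposableDecomposition.sup [IsModularLattice α] [DecidableEq α] {a b : α}
    (hab : Disjoint a b) (ha : HasIndecomposableDecomposition a)
    (hb : HasIndecomposableDecomposition b) : HasIndecomposableDecomposition (a ⊔ b) := by
  obtain ⟨s, hs, rfl, hs'⟩ := ha
  obtain ⟨t, ht, rfl, ht'⟩ := hb
  exact ⟨s ∪ t, hs.union ht hab, Finset.sup_union, fun b hb ↦
    (Finset.mem_union.1 hb).elim (hs' b) (ht' b)⟩

end Lattice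

/-! ### From lattice decompositions to modules; uniserial modules -/

section Modules

variable {R : Type u} [CommRing R] {M : Type u} [AddCommGroup M] [Module R M]

theorem Indecomposable.top_coe {A : Submodule R M} (h : Indecomposable A) :
    Indecomposable (⊤ : Submodule R A) := by
  intro B C hBC e
  have h1 := h (B.map A.subtype) (C.map A.subtype)
    ((Submodule.disjoint_map A.injective_subtype hBC))
    (by rw [← Submodule.map_sup, e, Submodule.map_subtype_top])
  have hinj := Submodule.map_injective_of_injective A.injective_subtype
  exact h1.imp (fun h ↦ hinj (h.trans (Submodule.map_bot _).symm))
    (fun h ↦ hinj (h.trans (Submodule.map_bot _).symm))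

theorem isInternal_of_supIndep [DecidableEq (Submodule R M)] {s : Finset (Submodule R M)}
    (hs : s.SupIndep id) (e : s.sup id = ⊤) : DirectSum.IsInternal fun A : s ↦ (A : Submodule R M) :=
  DirectSum.isInternal_submodule_of_iSupIndep_of_iSup_eq_top hs.independent (by
    rw [← e, Finset.sup_eq_iSup, iSup_subtype]; rfl)

theorem isUniserial_of_forall_mem_span
    (h : ∀ a b : M, a ∈ Submodule.span R {b} ∨ b ∈ Submodule.span R {a}) : IsUniserial R M := by
  intro A B
  by_contra! hAB
  obtain ⟨⟨a, ha, haB⟩, ⟨b, hb, hbA⟩⟩ := And.imp SetLike.not_le_iff_exists.1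
    SetLike.not_le_iff_exists.1 hAB
  rcases h a b with hab | hab
  · exact haB ((Submodule.span_singleton_le_iff_mem b B).2 hb hab)
  · exact hbA ((Submodule.span_singleton_le_iff_mem a A).2 ha hab)

/-- A maximal cyclic submodule is comparable with every other cyclic one, so it contains them all.
-/
theorem IsUniserial.exists_span_singleton_eq_top [IsNoetherian R M] (h : IsUniserial R M) :
    ∃ x : M, Submodule.span R {x} = ⊤ := by
  obtain ⟨_, ⟨x, rfl⟩, hx⟩ := set_has_maximal_iff_noetherian.2 ‹IsNoetherian R M›
    (Set.range fun x : M ↦ Submodule.span R {x}) ⟨_, 0, rfl⟩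
  refine ⟨x, (Submodule.eq_top_iff').2 fun y ↦ ?_⟩
  rcases h (Submodule.span R {y}) (Submodule.span R {x}) with hyx | hxy
  · exact hyx (Submodule.mem_span_singleton_self y)
  · rw [eq_of_le_of_not_lt hxy (hx _ ⟨y, rfl⟩)]
    exact Submodule.mem_span_singleton_self y

/-! ### Indecomposable artinian modules -/

theorem exists_pow_add_mul_eq_one {P : Ideal R} [hP : P.IsMaximal] {t : R} (ht : t ∉ P) (n : ℕ) :
    ∃ q ∈ P ^ n, ∃ c, q + c * t = 1 := by
  obtain ⟨y, i, hi, e⟩ := hP.exists_inv ht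
  have hcop : IsCoprime (P ^ n) (Ideal.span {t}) :=
    IsCoprime.pow_left (Ideal.isCoprime_iff_exists.2
      ⟨i, hi, y * t, Ideal.mem_span_singleton'.2 ⟨y, rfl⟩, by rw [add_comm, e]⟩)
  obtain ⟨q, hq, b, hb, hab⟩ := Ideal.isCoprime_iff_exists.1 hcop
  obtain ⟨c, rfl⟩ := Ideal.mem_span_singleton'.1 hb
  exact ⟨q, hq, c, hab⟩

variable (M) in
/-- Every element of `M` is annihilated by a power of `P`. -/
def IsPowerTorsion (P : Ideal R) : Prop := ∀ x : M, ∃ n : ℕ, ∀ a ∈ P ^ n, a • x = 0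

/-- An indecomposable artinian module is `P`-primary for some maximal ideal `P`. -/
theorem exists_isPowerTorsion [IsArtinian R M] [Nontrivial M]
    (h : Indecomposable (⊤ : Submodule R M)) : ∃ P : Ideal R, P.IsMaximal ∧ IsPowerTorsion M P := by
  obtain ⟨S, hS⟩ := IsAtomic.exists_atom (Submodule R M)
  obtain ⟨P, hP, ⟨e⟩⟩ := isSimpleModule_iff_quot_maximal.1 (isSimpleModule_iff_isAtom.2 hS)
  refine ⟨P, hP, ?_⟩
  let T : Submodule R M :=
    { carrier := {x | ∃ n : ℕ, ∀ a ∈ P ^ n, a • x = 0}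
      add_mem' := by
        rintro x y ⟨n, hn⟩ ⟨m, hm⟩
        refine ⟨n + m, fun a ha ↦ ?_⟩
        rw [smul_add, hn a (Ideal.pow_le_pow_right (Nat.le_add_right n m) ha),
          hm a (Ideal.pow_le_pow_right (Nat.le_add_left m n) ha), add_zero]
      zero_mem' := ⟨0, fun a _ ↦ smul_zero a⟩
      smul_mem' := by
        rintro r x ⟨n, hn⟩
        exact ⟨n, fun a ha ↦ by rw [smul_comm, hn a ha, smul_zero]⟩ }
  let T' : Submodule R M :=
    { carrier := {x | ∃ t ∉ P, t • x = 0}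
      add_mem' := by
        rintro x y ⟨t, ht, hx⟩ ⟨s, hs, hy⟩
        refine ⟨t * s, fun hts ↦ (hP.isPrime.mem_or_mem hts).elim ht hs, ?_⟩
        rw [smul_add, mul_smul, mul_smul, hy, smul_comm, hx]; simp
      zero_mem' := ⟨1, fun h1 ↦ hP.ne_top ((Ideal.eq_top_iff_one P).2 h1), smul_zero _⟩
      smul_mem' := by
        rintro r x ⟨t, ht, hx⟩
        exact ⟨t, ht, by rw [smul_comm, hx, smul_zero]⟩ }
  have hdisj : Disjoint T T' := by
    rw [Submodule.disjoint_def]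
    rintro x ⟨n, hn⟩ ⟨t, ht, htx⟩
    obtain ⟨a, ha, c, hab⟩ := exists_pow_add_mul_eq_one ht n
    rw [← one_smul R x, ← hab, add_smul, hn a ha, mul_smul, htx, smul_zero, add_zero]
  have hsup : T ⊔ T' = ⊤ := by
    rw [Submodule.eq_top_iff']
    intro x
    let X := Submodule.span R {x}
    have hX : IsNoetherian R X := isNoetherian_of_finite_isArtinian X
    -- The chain `P ^ n x` becomes stationary, so by Nakayama some `r ∉ P` kills `P ^ n x`. Writing
    -- `1 = a + c * r` with `a ∈ P ^ n` splits `x` into `a • x`, killed by `r`, and a multiple of `r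
    -- • x`, killed by `P ^ n`.
    obtain ⟨n, hn⟩ := IsArtinian.monotone_stabilizes (R := R) (M := M)
      ⟨fun n ↦ OrderDual.toDual (P ^ n • X), fun m n hmn ↦
        Submodule.smul_mono_left (Ideal.pow_le_pow_right hmn)⟩
    have hn' : P ^ n • X = P ^ (n + 1) • X := congrArg OrderDual.ofDual (hn (n + 1) (Nat.le_succ n))
    have hfg : (P ^ n • X).FG :=
      Submodule.FG.of_le_of_isNoetherian Submodule.smul_le_right
    obtain ⟨r, hr, hrx⟩ := Submodule.exists_sub_one_mem_and_smul_eq_zero_of_fg_of_le_smul P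
      (P ^ n • X) hfg (by rw [← mul_smul, ← pow_succ', ← hn'])
    have hrP : r ∉ P := fun h0 ↦ hP.ne_top ((Ideal.eq_top_iff_one P).2 (by
      simpa using P.sub_mem h0 hr))
    obtain ⟨a, ha, c, hab⟩ := exists_pow_add_mul_eq_one hrP n
    rw [← one_smul R x, ← hab, add_smul, add_comm]
    have hxX : x ∈ X := Submodule.mem_span_singleton_self x
    refine Submodule.add_mem_sup ⟨n, fun q hq ↦ ?_⟩ ⟨r, hrP, hrx _ (Submodule.smul_mem_smul ha hxX)⟩
    rw [mul_smul, smul_comm, smul_comm q, hrx _ (Submodule.smul_mem_smul hq hxX), smul_zero]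
  -- `T` contains the simple submodule `S`, which is isomorphic to `R ⧸ P`, so it is `T'` that
  -- vanishes.
  rcases h T T' hdisj hsup with hT | hT
  · exfalso
    apply hS.1
    rw [eq_bot_iff, ← hT]
    intro x hx
    refine ⟨1, fun a ha ↦ ?_⟩
    rw [pow_one] at ha
    have : a • (⟨x, hx⟩ : S) = 0 := by
      apply e.injective
      obtain ⟨y, hy⟩ := Ideal.Quotient.mk_surjective (e ⟨x, hx⟩)
      rw [map_smul, ← hy, map_zero, ← Ideal.Quotient.mk_eq_mk, ← Submodule.Quotient.mk_smul,
        Submodule.Quotient.mk_eq_zero]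
      exact P.mul_mem_right _ ha
    exact congrArg Subtype.val this
  · rw [hT, sup_bot_eq] at hsup
    intro x
    have : x ∈ T := hsup ▸ trivial
    exact this

/-- `P` is generated by one element modulo `P ^ 2`. -/
def CotangentCyclic (P : Ideal R) : Prop := ∃ p ∈ P, P ≤ Ideal.span {p} ⊔ P ^ 2

theorem le_span_singleton_sup_pow {P : Ideal R} {p : R} (h : P ≤ Ideal.span {p} ⊔ P ^ 2) (n : ℕ) :
    P ≤ Ideal.span {p} ⊔ P ^ n := by
  induction n with
  | zero => simp
  | succ n ih =>
    refine h.trans (sup_le le_sup_left ?_)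
    calc P ^ 2 = P * P := sq P
      _ ≤ (Ideal.span {p} ⊔ P ^ n) * P := Ideal.mul_mono_left ih
      _ = Ideal.span {p} * P ⊔ P ^ (n + 1) := by rw [Ideal.sup_mul, pow_succ]
      _ ≤ Ideal.span {p} ⊔ P ^ (n + 1) := sup_le_sup_right Ideal.mul_le_left _

/-- An element outside `P` acts invertibly on `x`. An element of `P` is `r * p` up to something
killing `x`, and the claim for `r` acting on `p • x`, which a smaller power of `P` kills, finishes
the induction. -/
theorem exists_span_smul_eq_span_pow_smul {P : Ideal R} [hP : P.IsMaximal] {p : R} (hp : p ∈ P)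
    (h : P ≤ Ideal.span {p} ⊔ P ^ 2) {x : M} {n : ℕ} (hx : ∀ a ∈ P ^ n, a • x = 0) (a : R) :
    ∃ k, Submodule.span R {a • x} = Submodule.span R {p ^ k • x} := by
  induction n generalizing x a with
  | zero =>
    have : x = 0 := by simpa using hx 1 (by simp)
    exact ⟨0, by simp [this]⟩
  | succ n ih =>
    by_cases ha : a ∈ P
    · obtain ⟨b, hb, c, hc, rfl⟩ := Submodule.mem_sup.1 (le_span_singleton_sup_pow h (n + 1) ha)
      obtain ⟨r, rfl⟩ := Ideal.mem_span_singleton'.1 hb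
      have hpx : ∀ q ∈ P ^ n, q • (p • x) = 0 := by
        intro q hq
        rw [← mul_smul]
        exact hx _ (by rw [pow_succ]; exact Ideal.mul_mem_mul hq hp)
      obtain ⟨k, hk⟩ := ih hpx r
      refine ⟨k + 1, ?_⟩
      rw [add_smul, hx c hc, add_zero, mul_smul, hk, pow_succ, mul_smul]
    · refine ⟨0, ?_⟩
      obtain ⟨q, hq, c, hab⟩ := exists_pow_add_mul_eq_one ha (n + 1)
      rw [pow_zero, one_smul]
      apply le_antisymm
      · rw [Submodule.span_singleton_le_iff_mem]
        exact Submodule.smul_mem _ _ (Submodule.mem_span_singleton_self x)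
      · rw [Submodule.span_singleton_le_iff_mem, Submodule.mem_span_singleton]
        refine ⟨c, ?_⟩
        rw [← mul_smul]
        conv_rhs => rw [← one_smul R x, ← hab, add_smul, hx q hq, zero_add]

theorem mem_span_or_mem_span {P : Ideal R} [P.IsMaximal] {p : R} (hp : p ∈ P)
    (h : P ≤ Ideal.span {p} ⊔ P ^ 2) {x : M} {n : ℕ} (hx : ∀ a ∈ P ^ n, a • x = 0) {y z : M}
    (hy : y ∈ Submodule.span R {x}) (hz : z ∈ Submodule.span R {x}) :
    y ∈ Submodule.span R {z} ∨ z ∈ Submodule.span R {y} := by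
  obtain ⟨a, rfl⟩ := Submodule.mem_span_singleton.1 hy
  obtain ⟨b, rfl⟩ := Submodule.mem_span_singleton.1 hz
  obtain ⟨k, hk⟩ := exists_span_smul_eq_span_pow_smul hp h hx a
  obtain ⟨l, hl⟩ := exists_span_smul_eq_span_pow_smul hp h hx b
  rw [← Submodule.span_singleton_le_iff_mem, ← Submodule.span_singleton_le_iff_mem, hk, hl]
  have key : ∀ i j : ℕ, i ≤ j → Submodule.span R {p ^ j • x} ≤ Submodule.span R {p ^ i • x} := by
    intro i j hij
    obtain ⟨m, rfl⟩ := Nat.exists_eq_add_of_le' hij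
    rw [Submodule.span_singleton_le_iff_mem, pow_add, mul_smul]
    exact Submodule.smul_mem _ _ (Submodule.mem_span_singleton_self _)
  exact (le_total l k).imp (key l k) (key k l)

theorem exists_maximal_disjoint (D : Submodule R M) :
    ∃ C : Submodule R M, Disjoint C D ∧ ∀ C', C ≤ C' → Disjoint C' D → C' = C := by
  obtain ⟨C, -, hC⟩ := zorn_le_nonempty₀ {C : Submodule R M | Disjoint C D}
    (fun c hc hchain _ _ ↦ ⟨sSup c, hchain.directedOn.disjoint_sSup_left.2 hc,
      fun _ ↦ le_sSup⟩) ⊥ disjoint_bot_left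
  exact ⟨C, hC.1, fun C' hCC' hC' ↦ le_antisymm (hC.2 hC' hCC') hCC'⟩

/-- A submodule `D` of a `P`-primary module has a complement if `D ∩ (pM + C) = pD + (D ∩ C)`
for all submodules `C` that are disjoint from `D`. -/
theorem exists_isCompl_of_forall_smul {P : Ideal R} [hP : P.IsMaximal] {p : R} (hp : p ∈ P)
    (h : P ≤ Ideal.span {p} ⊔ P ^ 2) (hM : IsPowerTorsion M P) (D : Submodule R M)
    (hD : ∀ C : Submodule R M, Disjoint C D → ∀ x, ∀ c ∈ C, ∀ d ∈ D, p • x = c + d →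
      ∃ d' ∈ D, d = p • d') : ∃ C, IsCompl C D := by
  obtain ⟨C, hCD, hmax⟩ := exists_maximal_disjoint D
  refine ⟨C, hCD, codisjoint_iff.2 ?_⟩
  -- Correcting `x` by an element of `D` gives `w` with `p • w ∈ C`. If `w ∉ C ⊔ D`, maximality of
  -- `C` yields a nonzero `c' + r • w` in `D`. For `r ∈ P` it lies in `C` as well; for `r ∉ P` the
  -- scalar `r` can be inverted on `w`. Both are impossible.
  have step : ∀ x : M, p • x ∈ C ⊔ D → x ∈ C ⊔ D := by
    intro x hx
    obtain ⟨c, hc, d, hd, e⟩ := Submodule.mem_sup.1 hx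
    obtain ⟨d', hd', rfl⟩ := hD C hCD x c hc d hd e.symm
    have hpx : p • (x - d') = c := by rw [smul_sub, ← e, add_sub_cancel_right]
    suffices hs : x - d' ∈ C ⊔ D by
      simpa using Submodule.add_mem _ hs (Submodule.mem_sup_right hd' : d' ∈ C ⊔ D)
    generalize x - d' = w at hpx
    by_contra hw
    have hnd : ¬ Disjoint (C ⊔ Submodule.span R {w}) D := fun hdis ↦ hw (by
      have := hmax _ le_sup_left hdis
      rw [sup_eq_left, Submodule.span_singleton_le_iff_mem] at this
      exact Submodule.mem_sup_left this)
    rw [Submodule.disjoint_def] at hnd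
    push Not at hnd
    obtain ⟨y, hy, hyD, hy0⟩ := hnd
    obtain ⟨c', hc', z, hz, rfl⟩ := Submodule.mem_sup.1 hy
    obtain ⟨r, rfl⟩ := Submodule.mem_span_singleton.1 hz
    obtain ⟨n, hn⟩ := hM w
    by_cases hr : r ∈ P
    · obtain ⟨a, ha, b, hb, rfl⟩ := Submodule.mem_sup.1 (le_span_singleton_sup_pow h n hr)
      obtain ⟨s, rfl⟩ := Ideal.mem_span_singleton'.1 ha
      refine hy0 (Submodule.disjoint_def.1 hCD _ (C.add_mem hc' ?_) hyD)
      rw [add_smul, hn b hb, add_zero, mul_smul, hpx]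
      exact C.smul_mem _ hc
    · obtain ⟨q, hq, s, e⟩ := exists_pow_add_mul_eq_one hr n
      apply hw
      have : w = s • (r • w) := by
        conv_lhs => rw [← one_smul R w, ← e, add_smul, hn q hq, zero_add, mul_smul]
      rw [this]
      apply Submodule.smul_mem
      have h1 := Submodule.sub_mem _ (Submodule.mem_sup_right hyD : _ ∈ C ⊔ D)
        (Submodule.mem_sup_left hc' : _ ∈ C ⊔ D)
      rwa [add_sub_cancel_left] at h1
  rw [Submodule.eq_top_iff']
  intro x
  obtain ⟨n, hn⟩ := hM x
  have hn' : p ^ n • x ∈ C ⊔ D := by rw [hn _ (Ideal.pow_mem_pow hp n)]; exact zero_mem _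
  clear hn
  induction n with
  | zero => simpa using hn'
  | succ n ih => exact ih (step _ (by rwa [← mul_smul, ← pow_succ']))

theorem IsUniserial.of_subsingleton [Subsingleton M] : IsUniserial R M :=
  isUniserial_of_forall_mem_span fun a b ↦ Or.inl (by
    rw [Subsingleton.elim a 0]; exact Submodule.zero_mem _)

/-- As for abelian `p`-groups: if a power of `p` kills `M`, a cyclic submodule of maximal exponent
is a direct summand; otherwise the stable image `p ^ n M` is `p`-divisible and contains a
quasi-cyclic submodule, which is again a summand. By indecomposability the summand is all of `M`. -/
theorem isUniserial_of_isPowerTorsion [IsArtinian R M] [Nontrivial M] {P : Ideal R} [P.IsMaximal]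
    (hP : CotangentCyclic P) (hM : IsPowerTorsion M P)
    (hind : Indecomposable (⊤ : Submodule R M)) : IsUniserial R M := by
  obtain ⟨p, hp, h⟩ := hP
  have summand : ∀ D : Submodule R M, D ≠ ⊥ → (∀ C : Submodule R M, Disjoint C D → ∀ x, ∀ c ∈ C,
      ∀ d ∈ D, p • x = c + d → ∃ d' ∈ D, d = p • d') → D = ⊤ := by
    intro D hD0 hD
    obtain ⟨C, hC⟩ := exists_isCompl_of_forall_smul hp h hM D hD
    rcases hind C D hC.disjoint hC.sup_eq_top with h0 | h0
    · have := hC.sup_eq_top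
      rwa [h0, bot_sup_eq] at this
    · exact absurd h0 hD0
  obtain ⟨n, hn⟩ := IsArtinian.monotone_stabilizes (R := R) (M := M)
    ⟨fun n ↦ OrderDual.toDual (p ^ n • (⊤ : Submodule R M)), fun m n hmn ↦ by
      obtain ⟨k, rfl⟩ := Nat.exists_eq_add_of_le hmn
      rintro _ ⟨x, -, rfl⟩
      exact ⟨p ^ k • x, trivial, by
        change p ^ m • p ^ k • x = p ^ (m + k) • x
        rw [pow_add, mul_smul]⟩⟩
  have hn' : p ^ n • (⊤ : Submodule R M) = p ^ (n + 1) • (⊤ : Submodule R M) :=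
    congrArg OrderDual.ofDual (hn (n + 1) (Nat.le_succ n))
  by_cases hE : ∀ x : M, p ^ n • x = 0
  · classical
    have hex : ∃ n, ∀ x : M, p ^ n • x = 0 := ⟨n, hE⟩
    obtain ⟨m, hm⟩ : ∃ m, Nat.find hex = m + 1 := by
      refine Nat.exists_eq_succ_of_ne_zero fun h0 ↦ ?_
      obtain ⟨x, hx⟩ := exists_ne (0 : M)
      have := Nat.find_spec hex x
      rw [h0, pow_zero, one_smul] at this
      exact hx this
    have hm1 : ∀ x : M, p ^ (m + 1) • x = 0 := hm ▸ Nat.find_spec hex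
    obtain ⟨x, hx⟩ : ∃ x : M, p ^ m • x ≠ 0 := by
      have := Nat.find_min hex (m := m) (by omega)
      push Not at this
      exact this
    obtain ⟨k, hk⟩ := hM x
    have htop : Submodule.span R {x} = ⊤ := by
      refine summand _ ?_ ?_
      · rw [Ne, Submodule.span_singleton_eq_bot]
        rintro rfl
        exact hx (smul_zero _)
      · intro C hC y c hc d hd e
        obtain ⟨a, rfl⟩ := Submodule.mem_span_singleton.1 hd
        obtain ⟨j, hj⟩ := exists_span_smul_eq_span_pow_smul hp h hk a
        cases j with
        | succ j =>
          obtain ⟨s, hs⟩ := Submodule.mem_span_singleton.1 (hj ▸ Submodule.mem_span_singleton_self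
            (a • x) : a • x ∈ Submodule.span R {p ^ (j + 1) • x})
          refine ⟨s • p ^ j • x, Submodule.smul_mem _ _ (Submodule.smul_mem _ _
            (Submodule.mem_span_singleton_self x)), ?_⟩
          rw [← hs, smul_comm p s, ← mul_smul p, ← pow_succ']
        | zero =>
          exfalso
          -- Here `a • x` generates `R x`. Applying `p ^ m` to `p • y = c + a • x` puts `p ^ m • (a
          -- • x)` in `C ∩ D = 0`, which forces `p ^ m • x = 0`.
          rw [pow_zero, one_smul] at hj
          obtain ⟨s, hs⟩ := Submodule.mem_span_singleton.1 (hj.symm ▸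
            Submodule.mem_span_singleton_self x : x ∈ Submodule.span R {a • x})
          have h1 : p ^ m • (a • x) = 0 := by
            refine Submodule.disjoint_def.1 hC _ ?_ (Submodule.smul_mem _ _ hd)
            have h2 : p ^ m • c + p ^ m • (a • x) = 0 := by
              rw [← smul_add, ← e, ← mul_smul, ← pow_succ, hm1]
            rw [← neg_eq_of_add_eq_zero_right h2]
            exact C.neg_mem (C.smul_mem _ hc)
          apply hx
          rw [← hs, smul_comm, h1, smul_zero]
    exact isUniserial_of_forall_mem_span fun a b ↦ mem_span_or_mem_span hp h hk
      (htop ▸ trivial) (htop ▸ trivial)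
  · push Not at hE
    obtain ⟨y, hy⟩ := hE
    have hdiv : ∀ e : (p ^ n • (⊤ : Submodule R M) : Submodule R M),
        ∃ e' : (p ^ n • (⊤ : Submodule R M) : Submodule R M), p • (e' : M) = e := by
      rintro ⟨e, he⟩
      rw [hn'] at he
      obtain ⟨z, -, rfl⟩ := he
      refine ⟨⟨p ^ n • z, z, trivial, rfl⟩, ?_⟩
      change p • p ^ n • z = p ^ (n + 1) • z
      rw [pow_succ', mul_smul]
    choose f hf using hdiv
    -- Successive division by `p` inside `p ^ n M`, starting from a nonzero element, gives an
    -- increasing chain of cyclic submodules with `p`-divisible union.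
    let x : ℕ → M := fun i ↦ (f^[i] ⟨p ^ n • y, y, trivial, rfl⟩ : _)
    have hx : ∀ i, p • x (i + 1) = x i := fun i ↦ by
      simp only [x, Function.iterate_succ_apply']
      exact hf _
    have hmono : Monotone fun i ↦ Submodule.span R {x i} := monotone_nat_of_le_succ fun i ↦ by
      rw [Submodule.span_singleton_le_iff_mem, ← hx i]
      exact Submodule.smul_mem _ _ (Submodule.mem_span_singleton_self _)
    have hmem : ∀ z, z ∈ (⨆ i, Submodule.span R {x i}) ↔ ∃ i, z ∈ Submodule.span R {x i} :=
      fun z ↦ Submodule.mem_iSup_of_directed _ hmono.directed_le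
    have htop : (⨆ i, Submodule.span R {x i}) = ⊤ := by
      refine summand _ ?_ ?_
      · intro h0
        have : x 0 ∈ (⨆ i, Submodule.span R {x i}) :=
          (hmem _).2 ⟨0, Submodule.mem_span_singleton_self _⟩
        rw [h0] at this
        exact hy this
      · intro C _ z c _ d hd _
        obtain ⟨i, hi⟩ := (hmem d).1 hd
        obtain ⟨r, rfl⟩ := Submodule.mem_span_singleton.1 hi
        refine ⟨r • x (i + 1), (hmem _).2 ⟨i + 1, Submodule.smul_mem _ _
          (Submodule.mem_span_singleton_self _)⟩, ?_⟩
        rw [smul_comm, hx]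
    refine isUniserial_of_forall_mem_span fun a b ↦ ?_
    obtain ⟨i, hi⟩ := (hmem a).1 (htop ▸ trivial)
    obtain ⟨j, hj⟩ := (hmem b).1 (htop ▸ trivial)
    obtain ⟨k, hk⟩ := hM (x (max i j))
    exact mem_span_or_mem_span hp h hk (hmono (le_max_left i j) hi) (hmono (le_max_right i j) hj)

theorem isUniserial_of_indecomposable [IsArtinian R M]
    (hR : ∀ P : Ideal R, P.IsMaximal → CotangentCyclic P)
    (h : Indecomposable (⊤ : Submodule R M)) : IsUniserial R M := by
  cases subsingleton_or_nontrivial M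
  · exact IsUniserial.of_subsingleton
  · obtain ⟨P, hP, hM⟩ := exists_isPowerTorsion h
    exact isUniserial_of_isPowerTorsion (hR P hP) hM h

theorem isFiniteSumOfUniserials_of_isArtinian [IsArtinian R M]
    (hR : ∀ P : Ideal R, P.IsMaximal → CotangentCyclic P) : IsFiniteSumOfUniserials R M := by
  classical
  obtain ⟨s, hs, e, hind⟩ := induction_indecomposable_of_wellFoundedLT
    (HasIndecomposableDecomposition (α := Submodule R M))
    (fun _ h ↦ h.hasIndecomposableDecomposition) (fun _ _ h ha hb ↦ ha.sup h hb) ⊤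
  refine ⟨s.card, fun i ↦ (s.equivFin.symm i : Submodule R M), ?_, fun i ↦
    isUniserial_of_indecomposable hR (hind _ (s.equivFin.symm i).2).top_coe⟩
  refine DirectSum.isInternal_submodule_of_iSupIndep_of_iSup_eq_top
    (hs.independent.comp s.equivFin.symm.injective) ?_
  rw [s.equivFin.symm.iSup_comp (g := fun i : s ↦ (i : Submodule R M)), ← e, Finset.sup_eq_iSup,
    iSup_subtype]
  rfl

end Modules

/-! ### Modules of finite length -/

section FiniteLength

variable {R : Type u} [CommRing R]

/-- A local common divisor `c ∈ P` of `a` and `p` has `t * p = s * c` with `s ∉ P`, since `p ∉ P ^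
2`. So `c` is itself locally a multiple of `p`. -/
theorem DirectedAt.exists_mul_eq {P : Ideal R} [hP : P.IsMaximal] (h : DirectedAt P) {p : R}
    (hp : p ∈ P) (hp2 : p ∉ P ^ 2) {a : R} (ha : a ∈ P) : ∃ t ∉ P, ∃ r, t * a = r * p := by
  obtain ⟨c, hc, t, ht, r, s, h1, h2⟩ := h a ha p hp
  have hs : s ∉ P := by
    intro hs
    apply hp2
    obtain ⟨q, hq, d, e⟩ := exists_pow_add_mul_eq_one ht 1
    rw [pow_one] at hq
    have : p = q * p + d * (s * c) := by rw [← h2]; linear_combination -p * e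
    rw [this, sq]
    exact Ideal.add_mem _ (Ideal.mul_mem_mul hq hp)
      (Ideal.mul_mem_left _ _ (Ideal.mul_mem_mul hs hc))
  exact ⟨s * t, fun hst ↦ (hP.isPrime.mem_or_mem hst).elim hs ht, r * t, by
    linear_combination s * h1 - r * h2⟩

theorem DirectedAt.le_span_singleton_sup_sq {P : Ideal R} [hP : P.IsMaximal] (h : DirectedAt P)
    {p : R} (hp : p ∈ P) (hp2 : p ∉ P ^ 2) : P ≤ Ideal.span {p} ⊔ P ^ 2 := by
  intro a ha
  obtain ⟨t, ht, r, e⟩ := h.exists_mul_eq hp hp2 ha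
  obtain ⟨q, hq, d, e'⟩ := exists_pow_add_mul_eq_one ht 1
  rw [pow_one] at hq
  have : a = (d * r) * p + q * a := by linear_combination (-a) * e' + d * e
  rw [this, sq]
  exact Submodule.add_mem_sup (Ideal.mul_mem_left _ _ (Ideal.mem_span_singleton_self p))
    (Ideal.mul_mem_mul hq ha)

theorem DirectedAt.cotangentCyclic {P : Ideal R} [hP : P.IsMaximal] (h : DirectedAt P) :
    CotangentCyclic P := by
  by_cases hPP : P ≤ P ^ 2
  · exact ⟨0, P.zero_mem, hPP.trans le_sup_right⟩
  · obtain ⟨p, hp, hp2⟩ := SetLike.not_le_iff_exists.1 hPP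
    exact ⟨p, hp, h.le_span_singleton_sup_sq hp hp2⟩

theorem pow_le_span_singleton_pow_sup_pow {P : Ideal R} {p : R}
    (h : P ≤ Ideal.span {p} ⊔ P ^ 2) (j k : ℕ) : P ^ j ≤ Ideal.span {p ^ j} ⊔ P ^ k := by
  induction j with
  | zero => simp
  | succ j ih =>
    calc P ^ (j + 1) = P ^ j * P := pow_succ _ _
      _ ≤ (Ideal.span {p ^ j} ⊔ P ^ k) * (Ideal.span {p} ⊔ P ^ k) :=
        Ideal.mul_mono ih (le_span_singleton_sup_pow h k)
      _ ≤ Ideal.span {p ^ (j + 1)} ⊔ P ^ k := by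
        rw [Ideal.sup_mul, Ideal.mul_sup, Ideal.span_singleton_mul_span_singleton, ← pow_succ]
        exact sup_le (sup_le_sup_left Ideal.mul_le_right _)
          (Ideal.mul_le_left.trans le_sup_right)

/-- While `j < k`, the cofactor `r` of `p ^ j` must lie in `P`: otherwise `p ^ j ∈ I`, hence `P ^ j
≤ I`, against minimality. So one more factor `p` can be split off. -/
theorem DirectedAt.exists_mul_eq_mul_pow {P : Ideal R} [hP : P.IsMaximal] (h : DirectedAt P)
    {p : R} (hp : p ∈ P) (hp2 : p ∉ P ^ 2) {I : Ideal R} {k : ℕ} (hk : P ^ k ≤ I)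
    (hmin : ∀ j < k, ¬ P ^ j ≤ I) {x : R} (hx : x ∈ I) {j : ℕ} (hj : j ≤ k) :
    ∃ t ∉ P, ∃ r, t * x = r * p ^ j := by
  induction j with
  | zero => exact ⟨1, fun h1 ↦ hP.ne_top ((Ideal.eq_top_iff_one P).2 h1), x, by simp⟩
  | succ j ih =>
    obtain ⟨t, ht, r, e⟩ := ih (Nat.le_of_succ_le hj)
    have hr : r ∈ P := by
      by_contra hr
      obtain ⟨q, hq, d, e'⟩ := exists_pow_add_mul_eq_one hr k
      apply hmin j hj
      refine (pow_le_span_singleton_pow_sup_pow (h.le_span_singleton_sup_sq hp hp2) j k).trans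
        (sup_le ?_ hk)
      rw [Ideal.span_singleton_le_iff_mem]
      have : p ^ j = q * p ^ j + d * (t * x) := by
        rw [e]; linear_combination (-p ^ j) * e'
      rw [this]
      exact I.add_mem (I.mul_mem_right _ (hk hq)) (I.mul_mem_left _ (I.mul_mem_left _ hx))
    obtain ⟨t', ht', r', e'⟩ := h.exists_mul_eq hp hp2 hr
    refine ⟨t' * t, fun htt ↦ (hP.isPrime.mem_or_mem htt).elim ht' ht, r', ?_⟩
    rw [pow_succ]
    linear_combination t' * e + p ^ j * e'

/-- If the localization at `P` satisfies the directedness condition, then every ideal containing a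
power of `P` is, locally at `P`, a directed union of principal ideals. -/
theorem DirectedAt.exists_of_pow_le {P : Ideal R} [hP : P.IsMaximal] (h : DirectedAt P)
    {I : Ideal R} (hI : I ≠ ⊤) {n : ℕ} (hn : P ^ n ≤ I) {a b : R} (ha : a ∈ I) (hb : b ∈ I) :
    ∃ c ∈ I, ∃ t ∉ P, ∃ r s, t * a = r * c ∧ t * b = s * c := by
  classical
  have hIP : I ≤ P := by
    obtain ⟨Q, hQ, hIQ⟩ := Ideal.exists_le_maximal I hI
    have := hP.eq_of_le hQ.ne_top (hQ.isPrime.le_of_pow_le (hn.trans hIQ))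
    rwa [this]
  have hex : ∃ n, P ^ n ≤ I := ⟨n, hn⟩
  obtain ⟨k, hk⟩ : ∃ k, Nat.find hex = k := ⟨_, rfl⟩
  have hkI : P ^ k ≤ I := hk ▸ Nat.find_spec hex
  have hkmin : ∀ j < k, ¬ P ^ j ≤ I := fun j hj ↦ Nat.find_min hex (by omega)
  by_cases hk1 : k ≤ 1
  · have hPI : P ≤ I := by
      have := (Ideal.pow_le_pow_right hk1).trans hkI
      rwa [pow_one] at this
    obtain ⟨c, hc, H⟩ := h a (hIP ha) b (hIP hb)
    exact ⟨c, hPI hc, H⟩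
  · have hPP : ¬ P ≤ P ^ 2 := by
      intro hPP
      have hall : ∀ m, P ≤ P ^ (m + 1) := by
        intro m
        induction m with
        | zero => simp
        | succ m ih =>
          calc P ≤ P ^ 2 := hPP
            _ = P * P := sq P
            _ ≤ P ^ (m + 1) * P := Ideal.mul_mono_left ih
            _ = P ^ (m + 1 + 1) := (pow_succ _ _).symm
      obtain ⟨m, rfl⟩ : ∃ m, k = m + 1 := ⟨k - 1, by omega⟩
      exact hkmin 1 (by omega) ((pow_one P).le.trans ((hall m).trans hkI))
    obtain ⟨p, hp, hp2⟩ := SetLike.not_le_iff_exists.1 hPP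
    have hpk : p ^ k ∈ I := hkI (Ideal.pow_mem_pow hp k)
    obtain ⟨t, ht, r, e⟩ := h.exists_mul_eq_mul_pow hp hp2 hkI hkmin ha le_rfl
    obtain ⟨t', ht', r', e'⟩ := 
      h.exists_mul_eq_mul_pow hp hp2 hkI hkmin hb le_rfl
    exact ⟨p ^ k, hpk, t * t', fun htt ↦ (hP.isPrime.mem_or_mem htt).elim ht ht', t' * r, t * r',
      by linear_combination t' * e, by linear_combination t * e'⟩

theorem DirectedAt.isRDFlat_quotient {P : Ideal R} [hP : P.IsMaximal] (h : DirectedAt P)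
    {I : Ideal R} {n : ℕ} (hn : P ^ n ≤ I) : IsRDFlat R (R ⧸ I) := by
  refine isRDFlat_quotient_of_smul_mem fun N F L _ _ _ _ _ _ f g hfg m hm ↦ ?_
  by_cases hI : I = ⊤
  · rw [hI, Submodule.top_smul]; trivial
  have key : ∀ x ∈ I • (⊤ : Submodule R F), ∃ c ∈ I, ∃ t ∉ P, ∃ y, t • x = c • y := by
    intro x hx
    refine Submodule.smul_induction_on hx ?_ ?_
    · intro c hc y _
      exact ⟨c, hc, 1, fun h1 ↦ hP.ne_top ((Ideal.eq_top_iff_one P).2 h1), y, one_smul _ _⟩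
    · rintro x x' ⟨c, hc, t, ht, y, e⟩ ⟨c', hc', t', ht', y', e'⟩
      obtain ⟨d, hd, s, hs, r, r', e1, e2⟩ := h.exists_of_pow_le hI hn hc hc'
      refine ⟨d, hd, s * (t * t'), fun h1 ↦ (hP.isPrime.mem_or_mem h1).elim hs fun h2 ↦
        (hP.isPrime.mem_or_mem h2).elim ht ht', (t' * r) • y + (t * r') • y', ?_⟩
      have h1 : (s * (t * t')) • x = (t' * (s * c)) • y := by
        rw [show s * (t * t') = (s * t') * t by ring, mul_smul, e, ← mul_smul]
        congr 1; ring
      have h2 : (s * (t * t')) • x' = (t * (s * c')) • y' := by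
        rw [show s * (t * t') = (s * t) * t' by ring, mul_smul, e', ← mul_smul]
        congr 1; ring
      rw [smul_add, h1, h2, e1, e2, smul_add, ← mul_smul, ← mul_smul]
      congr 2 <;> ring
  obtain ⟨c, hc, t, ht, y, e⟩ := key _ hm
  rw [← map_smul] at e
  obtain ⟨m', hm'⟩ := hfg.exists_smul_eq c y (t • m) e.symm
  obtain ⟨q, hq, d, hqd⟩ := exists_pow_add_mul_eq_one ht n
  rw [← one_smul R m, ← hqd, add_smul, mul_smul, hm']
  exact Submodule.add_mem _ (Submodule.smul_mem_smul (hn hq) trivial)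
    (Submodule.smul_mem _ _ (Submodule.smul_mem_smul hc trivial))

/-- A ring in which every element is associated to a power of one fixed nilpotent element is
self-injective. -/
theorem baer_self_of_span_eq_span_pow {A : Type u} [CommRing A] {p : A} {n : ℕ} (hn : p ^ n = 0)
    (h : ∀ a : A, ∃ k, Ideal.span {a} = Ideal.span {p ^ k}) : Module.Baer A A := by
  classical
  intro J g
  have hex : ∃ k, p ^ k ∈ J := ⟨n, by rw [hn]; exact J.zero_mem⟩
  obtain ⟨k, hk⟩ : ∃ k, Nat.find hex = k := ⟨_, rfl⟩
  have hkJ : p ^ k ∈ J := hk ▸ Nat.find_spec hex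
  have hmin : ∀ j, p ^ j ∈ J → k ≤ j := fun j hj ↦ hk ▸ Nat.find_min' hex hj
  have hJ : ∀ x ∈ J, ∃ y, y * p ^ k = x := by
    intro x hx
    obtain ⟨j, hj⟩ := h x
    have hjJ : p ^ j ∈ J := (Ideal.span_singleton_le_iff_mem J).2 hx
      (hj ▸ Ideal.mem_span_singleton_self _)
    obtain ⟨i, rfl⟩ := Nat.exists_eq_add_of_le' (hmin j hjJ)
    obtain ⟨y, hy⟩ := Ideal.mem_span_singleton'.1 (hj ▸ Ideal.mem_span_singleton_self x)
    exact ⟨y * p ^ i, by rw [← hy]; ring⟩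
  -- `J` is generated by `p ^ k`. If `m` is the exact nilpotency exponent of `p`, then `p ^ (m - k)`
  -- kills `g (p ^ k)`. This value is associated to some `p ^ l`, so `l ≥ k` and it is a multiple of
  -- `p ^ k`.
  obtain ⟨z, hz⟩ : ∃ z, z * p ^ k = g ⟨p ^ k, hkJ⟩ := by
    have hex' : ∃ m, p ^ m = 0 := ⟨n, hn⟩
    obtain ⟨m, hm⟩ : ∃ m, Nat.find hex' = m := ⟨_, rfl⟩
    have hm0 : p ^ m = 0 := hm ▸ Nat.find_spec hex'
    have hmmin : ∀ j, p ^ j = 0 → m ≤ j := fun j hj ↦ hm ▸ Nat.find_min' hex' hj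
    have hkm : k ≤ m := hmin m (by rw [hm0]; exact J.zero_mem)
    obtain ⟨l, hl⟩ := h (g ⟨p ^ k, hkJ⟩)
    have h1 : p ^ (m - k) * g ⟨p ^ k, hkJ⟩ = 0 := by
      rw [← smul_eq_mul, ← map_smul]
      have : p ^ (m - k) • (⟨p ^ k, hkJ⟩ : J) = 0 := by
        ext
        change p ^ (m - k) * p ^ k = 0
        rw [← pow_add, Nat.sub_add_cancel hkm, hm0]
      rw [this, map_zero]
    obtain ⟨w, hw⟩ := Ideal.mem_span_singleton'.1 (hl.symm ▸ Ideal.mem_span_singleton_self (p ^ l))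
    obtain ⟨v, hv⟩ := Ideal.mem_span_singleton'.1 (hl ▸ Ideal.mem_span_singleton_self
      (g ⟨p ^ k, hkJ⟩))
    have h2 : p ^ (m - k + l) = 0 := by
      rw [pow_add, ← hw, mul_left_comm, h1, mul_zero]
    have hkl : k ≤ l := by have := hmmin _ h2; omega
    obtain ⟨i, rfl⟩ := Nat.exists_eq_add_of_le' hkl
    exact ⟨v * p ^ i, by rw [← hv]; ring⟩
  refine ⟨LinearMap.toSpanSingleton A A z, fun x hx ↦ ?_⟩
  obtain ⟨y, rfl⟩ := hJ x hx
  have : (⟨y * p ^ k, hx⟩ : J) = y • ⟨p ^ k, hkJ⟩ := rfl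
  rw [this, map_smul, ← hz, LinearMap.toSpanSingleton_apply, smul_eq_mul, smul_eq_mul]
  ring

theorem CotangentCyclic.baer_quotient {P : Ideal R} [hP : P.IsMaximal] (h : CotangentCyclic P)
    {I : Ideal R} {n : ℕ} (hn : P ^ n ≤ I) : Module.Baer (R ⧸ I) (R ⧸ I) := by
  obtain ⟨p, hp, h⟩ := h
  refine baer_self_of_span_eq_span_pow (p := Ideal.Quotient.mk I p) (n := n) ?_ ?_
  · rw [← map_pow, Ideal.Quotient.eq_zero_iff_mem]
    exact hn (Ideal.pow_mem_pow hp n)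
  · intro a
    obtain ⟨a, rfl⟩ := Ideal.Quotient.mk_surjective a
    have hx : ∀ q ∈ P ^ n, q • (1 : R ⧸ I) = 0 := by
      intro q hq
      rw [Algebra.smul_def, mul_one, Ideal.Quotient.algebraMap_eq, Ideal.Quotient.eq_zero_iff_mem]
      exact hn hq
    obtain ⟨k, hk⟩ := exists_span_smul_eq_span_pow_smul hp h hx a
    refine ⟨k, ?_⟩
    have key : ∀ b c : R, Submodule.span R {b • (1 : R ⧸ I)} ≤ Submodule.span R {c • (1 : R ⧸ I)} →
        Ideal.span {Ideal.Quotient.mk I b} ≤ Ideal.span {Ideal.Quotient.mk I c} := by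
      intro b c hbc
      rw [Submodule.span_singleton_le_iff_mem, Submodule.mem_span_singleton] at hbc
      obtain ⟨r, hr⟩ := hbc
      rw [Algebra.smul_def, Algebra.smul_def, Algebra.smul_def, mul_one, mul_one,
        Ideal.Quotient.algebraMap_eq] at hr
      rw [Ideal.span_singleton_le_iff_mem, ← hr]
      exact Ideal.mul_mem_left _ _ (Ideal.mem_span_singleton_self _)
    rw [← map_pow]
    exact le_antisymm (key _ _ hk.le) (key _ _ hk.ge)

/-- A map `N → R ⧸ I` factors through `N ⧸ IN`, which embeds in `F ⧸ IF` by RD-flatness;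
self-injectivity of `R ⧸ I` then extends it. -/
theorem isRDInjective_quotient_of_baer {I : Ideal R} (hflat : IsRDFlat R (R ⧸ I))
    (hI : Module.Baer (R ⧸ I) (R ⧸ I)) : IsRDInjective R (R ⧸ I) := by
  refine isRDInjective_of_extension fun N F L _ _ _ _ _ _ f g hfg φ ↦ ?_
  let N' := N ⧸ I • (⊤ : Submodule R N)
  let F' := F ⧸ I • (⊤ : Submodule R F)
  have hsmulR : ∀ (r : R) (y : R ⧸ I), r • y = Ideal.Quotient.mk I r • y := fun r y ↦ by
    rw [Algebra.smul_def, Ideal.Quotient.algebraMap_eq, smul_eq_mul]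
  let f' : N' →ₗ[R] F' := Submodule.mapQ _ _ f (by
    rw [← Submodule.map_le_iff_le_comap, Submodule.map_smul'']
    exact Submodule.smul_mono le_rfl le_top)
  have hf' : Function.Injective f' := by
    rw [injective_iff_map_eq_zero]
    intro x hx
    obtain ⟨m, rfl⟩ := Submodule.mkQ_surjective _ x
    have : f m ∈ I • (⊤ : Submodule R F) := (Submodule.Quotient.mk_eq_zero _).1 hx
    exact (Submodule.Quotient.mk_eq_zero _).2 (hflat.mem_smul_top hfg this)
  let φ' : N' →ₗ[R] R ⧸ I := Submodule.liftQ _ φ (by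
    rw [Submodule.smul_le]
    intro r hr m _
    rw [LinearMap.mem_ker, map_smul, hsmulR, Ideal.Quotient.eq_zero_iff_mem.2 hr, zero_smul])
  have lin : ∀ {X Y : Type u} [AddCommGroup X] [Module R X] [Module (R ⧸ I) X]
      [IsScalarTower R (R ⧸ I) X] [AddCommGroup Y] [Module R Y] [Module (R ⧸ I) Y]
      [IsScalarTower R (R ⧸ I) Y] (α : X →ₗ[R] Y), ∃ β : X →ₗ[R ⧸ I] Y, ∀ x, β x = α x := by
    intro X Y _ _ _ _ _ _ _ _ α
    refine ⟨⟨α.toAddHom, fun r x ↦ ?_⟩, fun x ↦ rfl⟩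
    obtain ⟨r, rfl⟩ := Ideal.Quotient.mk_surjective r
    have h1 : ∀ {Z : Type u} [AddCommGroup Z] [Module R Z] [Module (R ⧸ I) Z]
        [IsScalarTower R (R ⧸ I) Z] (z : Z), Ideal.Quotient.mk I r • z = r • z := by
      intro Z _ _ _ _ z
      rw [← Ideal.Quotient.algebraMap_eq, algebraMap_smul]
    change α _ = Ideal.Quotient.mk I r • α x
    rw [h1, h1, map_smul]
  obtain ⟨f'', hf''⟩ := lin f'
  obtain ⟨φ'', hφ''⟩ := lin φ'
  obtain ⟨ψ, hψ⟩ := hI.injective.out f'' (fun x y e ↦ hf' (by rwa [hf'', hf''] at e)) φ''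
  refine ⟨ψ.restrictScalars R ∘ₗ Submodule.mkQ _, ?_⟩
  ext m
  have h1 := hψ (Submodule.mkQ _ m)
  rw [hf'', hφ''] at h1
  exact h1

/-- A property of modules of finite length that is invariant under isomorphism and direct sums
holds for all of them if it holds for all `R ⧸ I` with `I` containing a power of a maximal ideal. -/
theorem IsFiniteLength.induction_of_cotangentCyclic
    (hR : ∀ P : Ideal R, P.IsMaximal → CotangentCyclic P)
    (C : ∀ (M : Type u) [AddCommGroup M] [Module R M], Prop)
    (retract : ∀ (M A B : Type u) [AddCommGroup M] [Module R M] [AddCommGroup A] [Module R A]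
      [AddCommGroup B] [Module R B], C A → C B → ∀ (i : A →ₗ[R] M) (p : M →ₗ[R] A) (j : B →ₗ[R] M)
      (q : M →ₗ[R] B), i ∘ₗ p + j ∘ₗ q = LinearMap.id → C M)
    (quot : ∀ (P I : Ideal R) (n : ℕ), P.IsMaximal → P ^ n ≤ I → C (R ⧸ I))
    (bot : ∀ (M : Type u) [AddCommGroup M] [Module R M], Subsingleton M → C M)
    (M : Type u) [AddCommGroup M] [Module R M] (hM : IsFiniteLength R M) : C M := by
  obtain ⟨hN, hA⟩ := isFiniteLength_iff_isNoetherian_isArtinian.1 hM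
  have equiv : ∀ (M A : Type u) [AddCommGroup M] [Module R M] [AddCommGroup A] [Module R A],
      C A → (A ≃ₗ[R] M) → C M := fun M A _ _ _ _ h e ↦
    retract M A A h h e.toLinearMap e.symm.toLinearMap 0 0 (by ext; simp)
  refine equiv M (⊤ : Submodule R M) ?_ Submodule.topEquiv
  refine induction_indecomposable_of_wellFoundedLT (fun A : Submodule R M ↦ C A) ?_ ?_ ⊤
  · intro A hAind
    cases subsingleton_or_nontrivial A with
    | inl h => exact bot A h
    | inr h =>
      obtain ⟨P, hP, hPA⟩ := exists_isPowerTorsion hAind.top_coe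
      -- A noetherian uniserial module is cyclic, so the summand is `R ⧸ I` with `I` the annihilator
      -- of a generator, and `I` contains a power of `P`.
      obtain ⟨x, hx⟩ := (isUniserial_of_indecomposable hR
        hAind.top_coe).exists_span_singleton_eq_top
      obtain ⟨n, hn⟩ := hPA x
      refine equiv A (R ⧸ LinearMap.ker (LinearMap.toSpanSingleton R A x))
        (quot P _ n hP hn) (LinearMap.quotKerEquivOfSurjective _ ?_)
      rw [← LinearMap.range_eq_top, LinearMap.range_toSpanSingleton, hx]
  · intro A B hAB hCA hCB
    let A' : Submodule R (A ⊔ B : Submodule R M) := A.comap (A ⊔ B).subtype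
    let B' : Submodule R (A ⊔ B : Submodule R M) := B.comap (A ⊔ B).subtype
    have hc : IsCompl A' B' := by
      constructor
      · rw [Submodule.disjoint_def]
        intro x hx hy
        exact Subtype.ext (Submodule.disjoint_def.1 hAB x hx hy)
      · rw [codisjoint_iff, Submodule.eq_top_iff']
        rintro ⟨x, hx⟩
        obtain ⟨a, ha, b, hb, rfl⟩ := Submodule.mem_sup.1 hx
        have : (⟨a + b, hx⟩ : (A ⊔ B : Submodule R M)) = ⟨a, Submodule.mem_sup_left ha⟩ +
          ⟨b, Submodule.mem_sup_right hb⟩ := rfl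
        rw [this]
        exact Submodule.add_mem_sup ha hb
    refine retract _ A' B' (equiv _ A hCA (Submodule.comapSubtypeEquivOfLe le_sup_left).symm)
      (equiv _ B hCB (Submodule.comapSubtypeEquivOfLe le_sup_right).symm) A'.subtype
      (A'.projectionOnto B' hc) B'.subtype (B'.projectionOnto A' hc.symm) ?_
    exact Submodule.projection_add_projection_eq_id hc

theorem IsFiniteLength.isRDFlat (hR : ∀ P : Ideal R, P.IsMaximal → DirectedAt P) (M : Type u)
    [AddCommGroup M] [Module R M] (hM : IsFiniteLength R M) : IsRDFlat R M :=
  IsFiniteLength.induction_of_cotangentCyclic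
    (fun P hP ↦ (hR P hP).cotangentCyclic) (fun M [AddCommGroup M] [Module R M] ↦ IsRDFlat R M)
    (fun _ _ _ _ _ _ _ _ _ hA hB i p j q h ↦ hA.of_retracts hB i p j q h)
    (fun P _ _ hP hn ↦ (hR P hP).isRDFlat_quotient hn)
    (fun _ _ _ _ ↦ isRDFlat_of_injective fun _ _ _ _ _ _ _ _ _ _ _ _ ↦
      Function.injective_of_subsingleton _) M hM

theorem IsFiniteLength.isRDInjective (hR : ∀ P : Ideal R, P.IsMaximal → DirectedAt P) (M : Type u)
    [AddCommGroup M] [Module R M] (hM : IsFiniteLength R M) : IsRDInjective R M :=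
  IsFiniteLength.induction_of_cotangentCyclic
    (fun P hP ↦ (hR P hP).cotangentCyclic) (fun M [AddCommGroup M] [Module R M] ↦ IsRDInjective R M)
    (fun _ _ _ _ _ _ _ _ _ hA hB i p j q h ↦ hA.of_retracts hB i p j q h)
    (fun P _ _ hP hn ↦ isRDInjective_quotient_of_baer ((hR P hP).isRDFlat_quotient hn)
      ((hR P hP).cotangentCyclic.baer_quotient hn))
    (fun _ _ _ _ ↦ isRDInjective_of_extension fun _ _ _ _ _ _ _ _ _ _ _ _ _ ↦
      ⟨0, LinearMap.ext fun _ ↦ Subsingleton.elim _ _⟩) M hM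

end FiniteLength

/-! ### Noetherian modules -/

section Noetherian

theorem CotangentCyclic.map_of_surjective {R S : Type*} [CommRing R] [CommRing S] {f : R →+* S}
    (hf : Function.Surjective f) {P : Ideal S} (h : CotangentCyclic (P.comap f)) :
    CotangentCyclic P := by
  obtain ⟨p, hp, hle⟩ := h
  refine ⟨f p, hp, ?_⟩
  have := Ideal.map_mono (f := f) hle
  rwa [Ideal.map_comap_of_surjective f hf, Ideal.map_sup, Ideal.map_pow, Ideal.map_span,
    Set.image_singleton, Ideal.map_comap_of_surjective f hf] at this

variable {A : Type u} [CommRing A]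

/-- A ring without nontrivial idempotents has no ideal that is comaximal with its annihilator,
apart from the trivial ones. -/
theorem eq_bot_or_eq_top_of_add_eq_one (hA : ∀ e : A, e * e = e → e = 0 ∨ e = 1) {J : Ideal A}
    {q t : A} (hq : q ∈ J) (ht : ∀ x ∈ J, t * x = 0) (h : q + t = 1) : J = ⊥ ∨ J = ⊤ := by
  have hJ : ∀ x ∈ J, q * x = x := fun x hx ↦ by linear_combination x * h - ht x hx
  rcases hA q (hJ q hq) with rfl | rfl
  · exact Or.inl ((Submodule.eq_bot_iff _).2 fun x hx ↦ by rw [← hJ x hx, zero_mul])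
  · exact Or.inr ((Ideal.eq_top_iff_one J).2 hq)

/-- Nakayama for `P ⧸ (p)`: locally at `P`, the element `p` generates `P`. -/
theorem CotangentCyclic.exists_mul_mem_span_singleton [IsNoetherianRing A] {P : Ideal A}
    (hP : CotangentCyclic P) :
    ∃ p ∈ P, ∃ r, r - 1 ∈ P ∧ ∀ x ∈ P, r * x ∈ Ideal.span {p} := by
  obtain ⟨p, hp, h⟩ := hP
  obtain ⟨r, hr, hrP⟩ := Submodule.exists_sub_one_mem_and_smul_eq_zero_of_fg_of_le_smul P
    (Submodule.map (Submodule.mkQ (Ideal.span {p})) P)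
    (Submodule.FG.map _ (IsNoetherian.noetherian P)) (by
      rw [← Submodule.map_smul'', Submodule.map_le_iff_le_comap, Submodule.comap_map_mkQ,
        smul_eq_mul, ← sq]
      exact h)
  refine ⟨p, hp, r, hr, fun x hx ↦ ?_⟩
  have := hrP _ (Submodule.mem_map_of_mem hx)
  rw [← map_smul] at this
  exact (Submodule.Quotient.mk_eq_zero _).1 this

/-- In a noetherian ring with one-dimensional cotangent spaces, a prime that is strictly contained
in a maximal ideal `P` vanishes locally at `P`. -/
theorem exists_sub_one_mem_of_prime_lt [IsNoetherianRing A] {P Q : Ideal A}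
    (hP : CotangentCyclic P) (hPmax : P.IsMaximal) (hQ : Q.IsPrime) (hQP : Q < P) :
    ∃ t, t - 1 ∈ P ∧ ∀ x ∈ Q, t * x = 0 := by
  obtain ⟨p, hp, r, hr, hrP⟩ := hP.exists_mul_mem_span_singleton
  have hrP' : r ∉ P := fun h ↦ hPmax.ne_top ((Ideal.eq_top_iff_one P).2 (by
    simpa using P.sub_mem h hr))
  have hpQ : p ∉ Q := by
    intro hpQ
    refine hQP.not_ge fun x hx ↦ ?_
    exact (hQ.mem_or_mem ((Ideal.span_singleton_le_iff_mem Q).2 hpQ (hrP x hx))).resolve_left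
      fun h ↦ hrP' (hQP.le h)
  -- Locally `x ∈ Q` is `y * p` with `p ∉ Q`, so `y ∈ Q`. Nakayama then applies to `Q = PQ`.
  have hle : Q ≤ P • Q := by
    intro x hx
    obtain ⟨y, hy⟩ := Ideal.mem_span_singleton'.1 (hrP x (hQP.le hx))
    have hyQ : y ∈ Q := (hQ.mem_or_mem (hy ▸ Q.mul_mem_left r hx)).resolve_right hpQ
    have : x = p * y - (r - 1) * x := by linear_combination -hy
    rw [this]
    exact Submodule.sub_mem _ (Submodule.smul_mem_smul hp hyQ) (Submodule.smul_mem_smul hr hx)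
  exact Submodule.exists_sub_one_mem_and_smul_eq_zero_of_fg_of_le_smul P Q
    (IsNoetherian.noetherian Q) hle

/-- `Q` vanishes locally at each maximal ideal containing it, so it is comaximal with its
annihilator; connectedness leaves only `Q = 0`. -/
theorem eq_bot_of_isPrime_of_not_isMaximal [IsNoetherianRing A]
    (hA : ∀ e : A, e * e = e → e = 0 ∨ e = 1)
    (hR : ∀ P : Ideal A, P.IsMaximal → CotangentCyclic P) {Q : Ideal A} (hQ : Q.IsPrime)
    (hmax : ¬ Q.IsMaximal) : Q = ⊥ := by
  have hsup : Q ⊔ Module.annihilator A Q = ⊤ := by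
    by_contra hne
    obtain ⟨P, hP, hle⟩ := Ideal.exists_le_maximal _ hne
    have hQP : Q < P := lt_of_le_of_ne (le_sup_left.trans hle) fun h ↦ hmax (h ▸ hP)
    obtain ⟨t, ht, htQ⟩ := exists_sub_one_mem_of_prime_lt (hR P hP) hP hQ hQP
    have htP : t ∈ P := hle (Submodule.mem_sup_right (Module.mem_annihilator.2 fun x ↦
      Subtype.ext (htQ x x.2)))
    exact hP.ne_top ((Ideal.eq_top_iff_one P).2 (by simpa using P.sub_mem htP ht))
  obtain ⟨q, hq, t, ht, h⟩ := Submodule.mem_sup.1 ((Ideal.eq_top_iff_one _).1 hsup)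
  refine (eq_bot_or_eq_top_of_add_eq_one hA hq (fun x hx ↦ ?_) h).resolve_right hQ.ne_top
  exact congrArg Subtype.val (Module.mem_annihilator.1 ht ⟨x, hx⟩)

/-- Take `t` in a power of the product `J` of the other minimal primes: `J * Q` lies in the
nilradical, which is nilpotent. -/
theorem exists_notMem_mul_pow_eq_zero [IsNoetherianRing A] {Q : Ideal A}
    (hQ : Q ∈ minimalPrimes A) : ∃ t ∉ Q, ∃ n, ∀ x ∈ Q ^ n, t * x = 0 := by
  classical
  have hQ' : Q.IsPrime := Ideal.IsMinimalPrime.isPrime hQ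
  have hfin := minimalPrimes.finite_of_isNoetherianRing A
  obtain ⟨n, hn⟩ := (⊥ : Ideal A).exists_radical_pow_le_of_fg
    (⊥ : Ideal A).radical.fg_of_isNoetherianRing
  let J : Ideal A := ∏ P ∈ hfin.toFinset.erase Q, P
  have hJ : ¬ J ^ n ≤ Q := by
    intro h
    obtain ⟨P, hP, hPQ⟩ := (Ideal.IsPrime.prod_le hQ').1 (hQ'.le_of_pow_le h)
    rw [Finset.mem_erase, Set.Finite.mem_toFinset] at hP
    exact hP.1 (le_antisymm hPQ (hQ.2 hP.2.1 hPQ))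
  obtain ⟨t, ht, htQ⟩ := SetLike.not_le_iff_exists.1 hJ
  refine ⟨t, htQ, n, fun x hx ↦ ?_⟩
  have h1 : J * Q ≤ (⊥ : Ideal A).radical := by
    rw [← Ideal.sInf_minimalPrimes]
    refine le_sInf fun P hP ↦ ?_
    by_cases hPQ : P = Q
    · rw [hPQ]; exact Ideal.mul_le_right
    · refine Ideal.mul_le_left.trans (Ideal.prod_le_inf.trans (Finset.inf_le ?_))
      exact Finset.mem_erase.2 ⟨hPQ, hfin.mem_toFinset.2 hP⟩
  have h2 := (Ideal.pow_right_mono h1 n).trans hn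
  rw [mul_pow] at h2
  exact h2 (Ideal.mul_mem_mul ht hx)

/-- A connected noetherian ring with one-dimensional cotangent spaces is either an artinian local
ring or a Dedekind domain. -/
theorem exists_pow_eq_bot_or_isDedekindDomain [IsNoetherianRing A] [Nontrivial A]
    (hA : ∀ e : A, e * e = e → e = 0 ∨ e = 1)
    (hR : ∀ P : Ideal A, P.IsMaximal → CotangentCyclic P) :
    (∃ (P : Ideal A) (n : ℕ), P.IsMaximal ∧ P ^ n = ⊥) ∨ IsDedekindDomain A := by
  obtain ⟨Q, hQ⟩ := Ideal.nonempty_minimalPrimes (I := (⊥ : Ideal A)) bot_ne_top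
  have hQ' : Q.IsPrime := Ideal.IsMinimalPrime.isPrime hQ
  -- If a minimal prime is maximal, one of its powers is comaximal with its annihilator, hence zero.
  -- If not, it is zero, and the domain has principal maximal ideals locally at its nonzero primes.
  by_cases hmax : Q.IsMaximal
  · left
    obtain ⟨t, ht, n, hn⟩ := exists_notMem_mul_pow_eq_zero hQ
    obtain ⟨q, hq, c, h⟩ := exists_pow_add_mul_eq_one ht n
    refine ⟨Q, n, hmax, (eq_bot_or_eq_top_of_add_eq_one hA hq
      (fun x hx ↦ by rw [mul_assoc, hn x hx, mul_zero]) h).resolve_right fun htop ↦ ht ?_⟩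
    have := hn 1 (htop ▸ trivial)
    rw [mul_one] at this
    exact this ▸ Q.zero_mem
  · right
    have hbot := eq_bot_of_isPrime_of_not_isMaximal hA hR hQ' hmax
    subst hbot
    have : IsDomain A := IsDomain.of_bot_isPrime A
    have hdvr : IsDedekindDomainDvr A :=
      { is_dvr_at_nonzero_prime := by
          intro P hP hP'
          have hPmax : P.IsMaximal := by
            by_contra hPmax
            exact hP (eq_bot_of_isPrime_of_not_isMaximal hA hR hP' hPmax)
          have hnoeth : IsNoetherianRing (Localization.AtPrime P) :=
            IsLocalization.isNoetherianRing P.primeCompl _ inferInstance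
          refine ((IsDiscreteValuationRing.TFAE (Localization.AtPrime P)
            (IsLocalization.AtPrime.not_isField A hP _)).out 0 4).2 ?_
          obtain ⟨p, hp, r, hr, hrP⟩ := (hR P hPmax).exists_mul_mem_span_singleton
          have hrP' : r ∉ P := fun h ↦ hPmax.ne_top ((Ideal.eq_top_iff_one P).2 (by
            simpa using P.sub_mem h hr))
          refine ⟨algebraMap A _ p, ?_⟩
          rw [← Localization.AtPrime.map_eq_maximalIdeal]
          apply le_antisymm
          · rw [Ideal.map_le_iff_le_comap]
            intro x hx
            obtain ⟨y, hy⟩ := Ideal.mem_span_singleton'.1 (hrP x hx)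
            refine Ideal.mem_span_singleton'.2
              ⟨IsLocalization.mk' _ y (⟨r, hrP'⟩ : P.primeCompl), ?_⟩
            rw [← IsLocalization.mk'_one (M := P.primeCompl), ← IsLocalization.mk'_mul,
              ← IsLocalization.mk'_one (M := P.primeCompl) _ x, IsLocalization.mk'_eq_iff_eq]
            congr 1
            simpa using hy
          · exact (Ideal.span_singleton_le_iff_mem _).2 (Ideal.mem_map_of_mem _ hp) }
    infer_instance

variable {M : Type u} [AddCommGroup M] [Module A M]

theorem Indecomposable.eq_zero_or_eq_one_of_isIdempotentElem
    (h : Indecomposable (⊤ : Submodule A M)) (hM : Module.annihilator A M = ⊥) (e : A)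
    (he : e * e = e) : e = 0 ∨ e = 1 := by
  have hann : ∀ a : A, (∀ x : M, a • x = 0) → a = 0 := fun a ha ↦ by
    have : a ∈ Module.annihilator A M := Module.mem_annihilator.2 ha
    rwa [hM] at this
  have hdisj : Disjoint (LinearMap.ker (LinearMap.lsmul A M e))
      (LinearMap.ker (LinearMap.lsmul A M (1 - e))) := by
    rw [Submodule.disjoint_def]
    intro x (hx : e • x = 0) (hy : (1 - e) • x = 0)
    rwa [sub_smul, one_smul, hx, sub_zero] at hy
  have hsup : LinearMap.ker (LinearMap.lsmul A M e) ⊔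
      LinearMap.ker (LinearMap.lsmul A M (1 - e)) = ⊤ := by
    rw [Submodule.eq_top_iff']
    intro x
    have : x = (1 - e) • x + e • x := by rw [← add_smul, sub_add_cancel, one_smul]
    rw [this]
    refine Submodule.add_mem_sup ?_ ?_
    · change e • (1 - e) • x = 0
      rw [← mul_smul, mul_sub, mul_one, he, sub_self, zero_smul]
    · change (1 - e) • e • x = 0
      rw [← mul_smul, sub_mul, one_mul, he, sub_self, zero_smul]
  rcases h _ _ hdisj hsup with h0 | h0
  · right
    rw [h0, bot_sup_eq] at hsup
    refine (sub_eq_zero.1 (hann _ fun x ↦ ?_)).symm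
    have : x ∈ LinearMap.ker (LinearMap.lsmul A M (1 - e)) := hsup ▸ trivial
    exact this
  · left
    rw [h0, sup_bot_eq] at hsup
    refine hann _ fun x ↦ ?_
    have : x ∈ LinearMap.ker (LinearMap.lsmul A M e) := hsup ▸ trivial
    exact this

/-- An indecomposable module has no nontrivial projective quotients. -/
theorem Indecomposable.injective_of_projective (h : Indecomposable (⊤ : Submodule A M))
    {L : Type u} [AddCommGroup L] [Module A L] [Module.Projective A L] [Nontrivial L]
    {g : M →ₗ[A] L} (hg : Function.Surjective g) : Function.Injective g := by
  obtain ⟨s, hs⟩ := g.exists_rightInverse_of_surjective (LinearMap.range_eq_top.2 hg)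
  have hs' : ∀ y, g (s y) = y := fun y ↦ LinearMap.congr_fun hs y
  have hdisj : Disjoint (LinearMap.ker g) (LinearMap.range s) := by
    rw [Submodule.disjoint_def]
    rintro _ hx ⟨y, rfl⟩
    rw [LinearMap.mem_ker, hs'] at hx
    rw [hx, map_zero]
  have hsup : LinearMap.ker g ⊔ LinearMap.range s = ⊤ := by
    rw [Submodule.eq_top_iff']
    intro x
    rw [← sub_add_cancel x (s (g x))]
    refine Submodule.add_mem_sup ?_ ⟨_, rfl⟩
    rw [LinearMap.mem_ker, map_sub, hs', sub_self]
  refine LinearMap.ker_eq_bot.1 ((h _ _ hdisj hsup).resolve_right fun h0 ↦ ?_)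
  obtain ⟨y, hy⟩ := exists_ne (0 : L)
  apply hy
  have : s y = 0 := (Submodule.eq_bot_iff _).1 h0 _ ⟨y, rfl⟩
  rw [← hs' y, this, map_zero]

theorem projective_of_isTorsionFree [IsDedekindDomain A] [Module.Finite A M]
    [Module.IsTorsionFree A M] : Module.Projective A M := by
  have : Module.FinitePresentation A M := Module.finitePresentation_of_finite A M
  exact Module.Flat.projective_of_finitePresentation

/-- Faithfulness makes `M` modulo torsion nonzero, and it is projective, so `M` has a nonzero
functional. Its image is a projective ideal, so indecomposability makes the functional injective and
`M` isomorphic to an ideal, which two elements generate. -/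
theorem exists_span_pair_eq_top_of_isDedekindDomain [IsDedekindDomain A] [Module.Finite A M]
    (hM : Module.annihilator A M = ⊥) (h : Indecomposable (⊤ : Submodule A M)) :
    ∃ x y : M, Submodule.span A {x, y} = ⊤ := by
  have htors : Nontrivial (M ⧸ Submodule.torsion A M) := by
    rw [Submodule.Quotient.nontrivial_iff]
    intro htop
    obtain ⟨a, ha, ha'⟩ := Submodule.annihilator_top_inter_nonZeroDivisors (R := A) (M := M)
      (fun x ↦ (htop ▸ trivial : x ∈ Submodule.torsion A M))
    rw [Submodule.annihilator_top, hM] at ha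
    exact nonZeroDivisors.ne_zero ha' ha
  have hproj : Module.Projective A (M ⧸ Submodule.torsion A M) := projective_of_isTorsionFree
  obtain ⟨z, hz⟩ := exists_ne (0 : M ⧸ Submodule.torsion A M)
  obtain ⟨φ, hφ⟩ := Module.Projective.exists_dual_ne_zero A hz
  let g : M →ₗ[A] A := φ ∘ₗ (Submodule.torsion A M).mkQ
  obtain ⟨w, rfl⟩ := Submodule.mkQ_surjective _ z
  have hw : g w ≠ 0 := hφ
  have : Nontrivial (LinearMap.range g) := ⟨⟨g w, w, rfl⟩, 0, fun e ↦ hw (congrArg Subtype.val e)⟩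
  have hproj' : Module.Projective A (LinearMap.range g) := projective_of_isTorsionFree
  have hinj : Function.Injective g.rangeRestrict :=
    h.injective_of_projective g.surjective_rangeRestrict
  obtain ⟨b, hb⟩ := IsDedekindDomain.exists_eq_span_pair (I := LinearMap.range g) ⟨w, rfl⟩ hw
  obtain ⟨y, rfl⟩ : b ∈ LinearMap.range g := by
    rw [hb]; exact Submodule.subset_span (by simp)
  refine ⟨w, y, (Submodule.eq_top_iff').2 fun x ↦ ?_⟩
  have hx : g x ∈ Ideal.span {g w, g y} := hb ▸ ⟨x, rfl⟩
  obtain ⟨a, c, hac⟩ := Submodule.mem_span_pair.1 hx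
  refine Submodule.mem_span_pair.2 ⟨a, c, hinj (Subtype.ext ?_)⟩
  change g (a • w + c • y) = g x
  rw [map_add, map_smul, map_smul, hac]

theorem exists_span_pair_eq_top_of_annihilator_eq_bot [IsNoetherian A M]
    (hR : ∀ P : Ideal A, P.IsMaximal → CotangentCyclic P) (hM : Module.annihilator A M = ⊥)
    (h : Indecomposable (⊤ : Submodule A M)) : ∃ x y : M, Submodule.span A {x, y} = ⊤ := by
  cases subsingleton_or_nontrivial M
  · exact ⟨0, 0, Subsingleton.elim _ _⟩
  have : Nontrivial A := Module.nontrivial A M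
  have hA : IsNoetherianRing A := by
    have h1 : IsNoetherianRing (A ⧸ Module.annihilator A M) :=
      isNoetherianRing_quotient_annihilator M
    rw [hM] at h1
    exact isNoetherianRing_of_ringEquiv _ (RingEquiv.quotientBot A)
  rcases exists_pow_eq_bot_or_isDedekindDomain
    (h.eq_zero_or_eq_one_of_isIdempotentElem hM) hR with ⟨P, n, hP, hPn⟩ | hD
  · have hfl : IsFiniteLength A M := isFiniteLength_of_pow_smul_eq_bot (P := P) (n := n) (by
      rw [hPn, Submodule.bot_smul])
    have := (isFiniteLength_iff_isNoetherian_isArtinian.1 hfl).2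
    obtain ⟨x, hx⟩ := (isUniserial_of_indecomposable hR h).exists_span_singleton_eq_top
    exact ⟨x, x, by simpa using hx⟩
  · exact exists_span_pair_eq_top_of_isDedekindDomain hM h

theorem exists_span_pair_eq_top [IsNoetherian A M]
    (hR : ∀ P : Ideal A, P.IsMaximal → CotangentCyclic P)
    (h : Indecomposable (⊤ : Submodule A M)) : ∃ x y : M, Submodule.span A {x, y} = ⊤ := by
  let B := A ⧸ Module.annihilator A M
  let _ : Module B M := Module.quotientAnnihilator
  have hsmul : ∀ (a : A) (m : M), (Ideal.Quotient.mk (Module.annihilator A M) a : B) • m = a • m :=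
    fun _ _ ↦ rfl
  have : IsScalarTower A B M := ⟨fun r a y ↦ by
    obtain ⟨a, rfl⟩ := Ideal.Quotient.mk_surjective a
    rw [← Ideal.Quotient.mk_eq_mk, ← Submodule.Quotient.mk_smul]
    exact mul_smul r a y⟩
  have hBM : IsNoetherian B M := isNoetherian_of_tower A inferInstance
  have hann : Module.annihilator B M = ⊥ := by
    rw [Submodule.eq_bot_iff]
    intro b hb
    obtain ⟨a, rfl⟩ := Ideal.Quotient.mk_surjective b
    exact Ideal.Quotient.eq_zero_iff_mem.2 (Module.mem_annihilator.2 fun m ↦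
      Module.mem_annihilator.1 hb m)
  have hind : Indecomposable (⊤ : Submodule B M) := by
    intro C D hCD hsup
    have hrs : ∀ E : Submodule B M, E.restrictScalars A = ⊥ → E = ⊥ := fun E hE ↦
      (Submodule.restrictScalars_eq_bot_iff A B M).1 hE
    refine (h (C.restrictScalars A) (D.restrictScalars A) ?_ ?_).imp (hrs C) (hrs D)
    · rw [Submodule.disjoint_def]
      exact fun x hx hy ↦ Submodule.disjoint_def.1 hCD x hx hy
    · rw [Submodule.eq_top_iff']
      intro x
      obtain ⟨c, hc, d, hd, rfl⟩ := Submodule.mem_sup.1 (hsup ▸ trivial : x ∈ C ⊔ D)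
      exact Submodule.add_mem_sup hc hd
  obtain ⟨x, y, hxy⟩ := exists_span_pair_eq_top_of_annihilator_eq_bot (A := B) (fun P hP ↦
    (hR _ (Ideal.comap_isMaximal_of_surjective _
      Ideal.Quotient.mk_surjective)).map_of_surjective Ideal.Quotient.mk_surjective) hann hind
  refine ⟨x, y, (Submodule.eq_top_iff').2 fun m ↦ ?_⟩
  obtain ⟨b, c, e⟩ := Submodule.mem_span_pair.1 (hxy ▸ trivial : m ∈ Submodule.span B {x, y})
  obtain ⟨b, rfl⟩ := Ideal.Quotient.mk_surjective b
  obtain ⟨c, rfl⟩ := Ideal.Quotient.mk_surjective c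
  exact Submodule.mem_span_pair.2 ⟨b, c, e⟩

theorem isSumOfTwoGenerated_of_isNoetherian [IsNoetherian A M]
    (hR : ∀ P : Ideal A, P.IsMaximal → CotangentCyclic P) : IsSumOfTwoGenerated A M := by
  classical
  obtain ⟨s, hs, e, hind⟩ := induction_indecomposable_of_wellFoundedGT
    (HasIndecomposableDecomposition (α := Submodule A M))
    (fun _ h ↦ h.hasIndecomposableDecomposition) (fun _ _ h ha hb ↦ ha.sup h hb) ⊤
  refine ⟨s, inferInstance, fun N ↦ N, isInternal_of_supIndep hs e, fun N ↦ ?_⟩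
  obtain ⟨x, y, hxy⟩ := exists_span_pair_eq_top hR (hind _ N.2).top_coe
  refine ⟨x, y, ?_⟩
  have := congrArg (Submodule.map (N : Submodule A M).subtype) hxy
  rw [Submodule.map_subtype_top, Submodule.map_span, Set.image_pair] at this
  exact this.symm

end Noetherian

/-! ### A perfect ring whose principal ideals are not locally directed -/

section Perfect

/-- Every `a ∈ P` is `b ^ p` with `b ∈ P`, so `P = P ^ 2` and the generator `0` suffices. -/
theorem cotangentCyclic_of_perfectRing {R : Type*} [CommRing R] (p : ℕ) [hp : Fact p.Prime]
    [CharP R p] [PerfectRing R p] {P : Ideal R} (hP : P.IsPrime) : CotangentCyclic P := by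
  refine ⟨0, P.zero_mem, fun a ha ↦ Submodule.mem_sup_right ?_⟩
  obtain ⟨b, rfl⟩ := surjective_frobenius R p a
  rw [frobenius_def] at ha ⊢
  exact Ideal.pow_le_pow_right hp.out.two_le
    (Ideal.pow_mem_pow (hP.mem_of_pow_mem p ha) p)

variable {A : Type u} [CommRing A] (p : ℕ) [hp : Fact p.Prime] [CharP A p]

theorem exists_forall_pow_eq_of (z : PerfectClosure A p) :
    ∃ n, ∀ m ≥ n, ∃ a, z ^ p ^ m = PerfectClosure.of A p a := by
  obtain ⟨n, a, ha⟩ := IsPRadical.pow_mem (PerfectClosure.of A p) p z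
  refine ⟨n, fun m hm ↦ ?_⟩
  obtain ⟨k, rfl⟩ := Nat.exists_eq_add_of_le hm
  exact ⟨a ^ p ^ k, by rw [pow_add, pow_mul, ← ha, map_pow]⟩

theorem perfectClosure_of_injective [IsDomain A] : Function.Injective (PerfectClosure.of A p) := by
  rw [injective_iff_map_eq_zero]
  intro a ha
  obtain ⟨n, hn⟩ := mem_pNilradical.1 (IsPRadical.ker_le (PerfectClosure.of A p) p ha)
  exact eq_zero_of_pow_eq_zero hn

/-- A high `p`-power brings a common divisor relation down to `A`. There `x` cannot divide `C`,
since it divides neither `T` nor `y`; hence `x ^ p ^ n` divides `U`, and cancelling it makes `T` a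
multiple of `C`, against `t ∉ P`. -/
theorem not_directedAt_perfectClosure [IsDomain A] {P : Ideal (PerfectClosure A p)} [hP : P.IsPrime] {x y : A}
    (hx : Prime x) (hxy : ¬ x ∣ y) (hxP : PerfectClosure.of A p x ∈ P)
    (hyP : PerfectClosure.of A p y ∈ P) : ¬ DirectedAt P := by
  intro h
  obtain ⟨c, hc, t, ht, r, s, h1, h2⟩ := h _ hxP _ hyP
  obtain ⟨n₁, H₁⟩ := exists_forall_pow_eq_of p c
  obtain ⟨n₂, H₂⟩ := exists_forall_pow_eq_of p t
  obtain ⟨n₃, H₃⟩ := exists_forall_pow_eq_of p r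
  obtain ⟨n₄, H₄⟩ := exists_forall_pow_eq_of p s
  let n := n₁ + n₂ + n₃ + n₄
  obtain ⟨C, hC⟩ := H₁ n (by omega)
  obtain ⟨T, hT⟩ := H₂ n (by omega)
  obtain ⟨U, hU⟩ := H₃ n (by omega)
  obtain ⟨V, hV⟩ := H₄ n (by omega)
  have hpn : p ^ n ≠ 0 := pow_ne_zero _ hp.out.ne_zero
  have e1 : T * x ^ p ^ n = U * C := by
    apply perfectClosure_of_injective p
    rw [map_mul, map_mul, map_pow, ← hT, ← hU, ← hC, ← mul_pow, ← mul_pow, h1]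
  have e2 : T * y ^ p ^ n = V * C := by
    apply perfectClosure_of_injective p
    rw [map_mul, map_mul, map_pow, ← hT, ← hV, ← hC, ← mul_pow, ← mul_pow, h2]
  have hCP : PerfectClosure.of A p C ∈ P := hC ▸ P.pow_mem_of_mem hc _ (Nat.pos_of_ne_zero hpn)
  have hTP : PerfectClosure.of A p T ∉ P := fun h ↦ ht (hP.mem_of_pow_mem _ (hT ▸ h))
  have hxC : ¬ x ∣ C := by
    intro hxC
    have : x ∣ T * y ^ p ^ n := e2 ▸ hxC.mul_left V
    rcases hx.dvd_or_dvd this with ⟨w, rfl⟩ | h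
    · exact hTP (by rw [map_mul]; exact P.mul_mem_right _ hxP)
    · exact hxy (hx.dvd_of_dvd_pow h)
  obtain ⟨W, rfl⟩ := hx.pow_dvd_of_dvd_mul_right _ hxC (Dvd.intro_left T e1)
  have e3 : T = W * C := by
    apply mul_right_cancel₀ (pow_ne_zero (p ^ n) hx.ne_zero)
    rw [e1]; ring
  exact hTP (by rw [e3, map_mul]; exact P.mul_mem_left _ hCP)

end Perfect

theorem exists_cotangentCyclic_not_locallyDirected :
    ∃ (R : Type u) (_ : CommRing R), (∀ P : Ideal R, P.IsMaximal → CotangentCyclic P) ∧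
      ¬ LocallyDirected R := by
  let A := MvPolynomial (ULift.{u} Bool) (ZMod 2)
  let φ : PerfectClosure A 2 →+* ZMod 2 :=
    PerfectClosure.lift A 2 (ZMod 2) (MvPolynomial.eval fun _ ↦ 0)
  refine ⟨PerfectClosure A 2, inferInstance,
    fun P hP ↦ cotangentCyclic_of_perfectRing 2 hP.isPrime, fun h ↦ ?_⟩
  have hmax : (RingHom.ker φ).IsMaximal :=
    RingHom.ker_isMaximal_of_surjective φ (ZMod.ringHom_surjective φ)
  have hX : ∀ i, PerfectClosure.of A 2 (MvPolynomial.X i) ∈ RingHom.ker φ := by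
    intro i
    have : φ.comp (PerfectClosure.of A 2) = MvPolynomial.eval fun _ ↦ 0 :=
      (PerfectClosure.lift A 2 (ZMod 2)).symm_apply_apply _
    rw [RingHom.mem_ker, ← RingHom.comp_apply, this, MvPolynomial.eval_X]
  exact not_directedAt_perfectClosure 2 (x := (MvPolynomial.X (ULift.up true) : A))
    MvPolynomial.X_prime
    (y := MvPolynomial.X (ULift.up false)) (by simp [MvPolynomial.X_dvd_X])
    (hX _) (hX _) (locallyDirected_iff.1 h _ hmax)

end RDPurity

/-! ### The main theorem -/

theorem theoremT :
    (∀ (R : Type u) [CommRing R],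
      List.TFAE [
        ∀ (M : Type u) [AddCommGroup M] [Module R M], IsSimpleModule R M → RDPurity.IsRDFlat R M,
        ∀ (M : Type u) [AddCommGroup M] [Module R M],
          IsSimpleModule R M → RDPurity.IsRDInjective R M,
        ∀ (M : Type u) [AddCommGroup M] [Module R M], IsFiniteLength R M → RDPurity.IsRDFlat R M,
        ∀ (M : Type u) [AddCommGroup M] [Module R M],
          IsFiniteLength R M → RDPurity.IsRDInjective R M,
        ∀ (M : Type u) [AddCommGroup M] [Module R M], IsArtinian R M → RDPurity.IsRDFlat R M,
        ∀ (M : Type u) [AddCommGroup M] [Module R M], IsNoetherian R M → RDPurity.IsRDCoflat R M,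
        RDPurity.LocallyDirected R] ∧
      (RDPurity.LocallyDirected R →
        (∀ (M : Type u) [AddCommGroup M] [Module R M],
          IsArtinian R M → RDPurity.IsFiniteSumOfUniserials R M) ∧
        (∀ (M : Type u) [AddCommGroup M] [Module R M],
          IsNoetherian R M → RDPurity.IsSumOfTwoGenerated R M))) ∧
    (∃ (R : Type u) (_ : CommRing R),
      (∀ (M : Type u) [AddCommGroup M] [Module R M],
        IsArtinian R M → RDPurity.IsFiniteSumOfUniserials R M) ∧
      (∀ (M : Type u) [AddCommGroup M] [Module R M],
        IsNoetherian R M → RDPurity.IsSumOfTwoGenerated R M) ∧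
      ¬ RDPurity.LocallyDirected R) := by
  refine ⟨fun R _ ↦ ⟨?_, fun h ↦ ?_⟩, ?_⟩
  · have quot : ∀ P : Ideal R, P.IsMaximal → IsSimpleModule R (R ⧸ P) := fun P hP ↦
      isSimpleModule_iff_quot_maximal.2 ⟨P, hP, ⟨LinearEquiv.refl R _⟩⟩
    have finiteLength : ∀ (M : Type u) [AddCommGroup M] [Module R M], IsSimpleModule R M →
        IsFiniteLength R M := fun M _ _ _ ↦
      isFiniteLength_iff_isNoetherian_isArtinian.2 ⟨inferInstance, inferInstance⟩
    tfae_have 1 → 7 := fun h ↦ RDPurity.locallyDirected_iff.2 fun P hP ↦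
      RDPurity.directedAt_of_isRDFlat (h _ (quot P hP))
    tfae_have 7 → 3 := fun h M _ _ hM ↦
      RDPurity.IsFiniteLength.isRDFlat (RDPurity.locallyDirected_iff.1 h) M hM
    tfae_have 7 → 4 := fun h M _ _ hM ↦
      RDPurity.IsFiniteLength.isRDInjective (RDPurity.locallyDirected_iff.1 h) M hM
    tfae_have 3 → 5 := fun h M _ _ _ ↦ RDPurity.isRDFlat_of_isArtinian h M
    tfae_have 5 → 1 := fun h M _ _ _ ↦ h M inferInstance
    tfae_have 4 → 2 := fun h M _ _ hM ↦ h M (finiteLength M hM)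
    tfae_have 2 → 1 := fun h M _ _ hM ↦ by
      obtain ⟨P, hP, ⟨e⟩⟩ := isSimpleModule_iff_quot_maximal.1 hM
      exact (RDPurity.isRDFlat_quotient_of_isRDInjective (h _ (quot P hP))).of_equiv e.symm
    tfae_have 4 → 6 := fun h M _ _ _ ↦ RDPurity.isRDCoflat_of_isNoetherian h M
    tfae_have 6 → 7 := fun h ↦ RDPurity.locallyDirected_iff.2 fun P hP ↦ by
      have := quot P hP
      exact RDPurity.directedAt_of_isRDCoflat (h _ inferInstance)
    tfae_finish
  · have hR : ∀ P : Ideal R, P.IsMaximal → RDPurity.CotangentCyclic P := fun P hP ↦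
      (RDPurity.locallyDirected_iff.1 h P hP).cotangentCyclic
    exact ⟨fun M _ _ _ ↦ RDPurity.isFiniteSumOfUniserials_of_isArtinian hR,
      fun M _ _ _ ↦ RDPurity.isSumOfTwoGenerated_of_isNoetherian hR⟩
  · obtain ⟨R, _, hR, h⟩ := RDPurity.exists_cotangentCyclic_not_locallyDirected.{u}
    exact ⟨R, inferInstance, fun M _ _ _ ↦ RDPurity.isFiniteSumOfUniserials_of_isArtinian hR,
      fun M _ _ _ ↦ RDPurity.isSumOfTwoGenerated_of_isNoetherian hR, h⟩
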